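/- Let $1\le d$ and let $$\mathcal L=\sum_{1\le i_1<\dots<i_d\le N}\mathcal L_{i_1,\dots,i_d}[u]\;\mathrm dt_{i_1}\wedge\dots\wedge \mathrm dt_{i_d}$$ be a $d$-form on multi-time $\mathbb R^N$ whose coefficients are smooth functions of a field $u:\mathbb R^N\to\mathbb C$ and finitely many of its partial derivatives $u_I$ ($I$ an $N$-index). Regard $\mathcal L$ as a $(0,d)$-form of the variational bicomplex, with vertical derivative $\delta$ and horizontal derivative $\mathrm d$, so that $$\delta\mathcal L=\sum_{I}\sum_{i_1<\dots<i_d}\frac{\partial \mathcal L_{i_1,\dots,i_d}}{\partial u_I}\,\delta u_I\wedge \mathrm dt_{i_1}\wedge\dots\wedge \mathrm dt_{i_d},$$ $$\mathrm d\big(f\,\delta u_I\wedge \mathrm dt_J\big)=-\sum_{j}(\mathrm D_{t_j}f)\,\delta u_I\wedge \mathrm dt_j\wedge \mathrm dt_J-\sum_j f\,\delta u_{It_j}\wedge \mathrm dt_j\wedge \mathrm dt_J ,$$ where $J=(j_1,\dots,j_{d-1})$, $\mathrm dt_J=\mathrm dt_{j_1}\wedge\dots\wedge\mathrm dt_{j_{d-1}}$,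 $u_{It_j}=\partial_{t_j}u_I$, and $\mathrm D_{t_j}$ is the total derivative. (The dependence on the complex variables $u_I$ may be holomorphic or merely smooth in the real sense; in the latter case $\frac{\partial f}{\partial u_I}\delta u_I$ stands for the full real differential $\frac{\partial f}{\partial u_I}\delta u_I+\frac{\partial f}{\partial \bar u_I}\delta \bar u_I$, and terms in $\delta\bar u_I$ are allowed in $(1,b)$-forms. Smoothness of the coefficients is only needed around the jets of the field $u$ under consideration.) Let $u:\mathbb R^N\to\mathbb C$ be a smooth field. If there exists a $(1,d-1)$-form $\Theta[u]=\sum f_{I,J}[u]\,\delta u_I\wedge \mathrm dt_{J}$ (a finite sum with coefficients smooth in finitely many partial derivatives of the field) such that $$\delta\mathcal L=\mathrm d\Theta$$ holds at all jets of $u$ (in particular, if it holds identically), then $u$ is a critical point of the action $S_\Gamma[u]=\int_\Gamma\mathcal L[u]$ for every oriented smooth $d$-dimensional submanifold $\Gamma\subset\mathbb R^N$, possibly with boundary. That is, for every smooth variation $v:\mathbb R^N\to\mathbb C$ that vanishes on a neighbourhood of $\partial\Gamma$ in $\mathbb R^N$ and for which $\Gamma\cap\operatorname{supp}v$ is compact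 (automatic if $\Gamma$ is compact), $$\frac{\mathrm d}{\mathrm d\varepsilon}\Big|_{\varepsilon=0}\int_\Gamma\big(\mathcal L[u+\varepsilon v]-\mathcal L[u]\big)=0 ,$$ which for compact $\Gamma$ says that $\frac{\mathrm d}{\mathrm d\varepsilon}\big|_{\varepsilon=0}S_\Gamma[u+\varepsilon v]=0$. -/

import Mathlib

open scoped ContDiff Topology

noncomputable section

namespace PluriLagrangian

/-! ### Multi-time, fields and jets -/

/-- Multi-time `ℝ^N`, with coordinates `t_j`. -/
abbrev MultiTime (N : ℕ) : Type := Fin N → ℝ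

/-- `N`-indices `I`; the entry `I j` counts the derivatives with respect to `t_j`. -/
abbrev MultiIndex (N : ℕ) : Type := Fin N → ℕ

/-- A point of the fibre of the infinite jet space: a value for every coordinate `u_I`. -/
abbrev Jet (N : ℕ) : Type := MultiIndex N → ℂ

/-- The space of (constant coefficient, complex valued) `b`-forms in `dt_1, …, dt_N`. -/
abbrev HCovector (N b : ℕ) : Type := (MultiTime N) [⋀^Fin b]→L[ℝ] ℂ

/-- The partial derivative `∂f/∂t_j`. -/
def partialDeriv {N : ℕ} (j : Fin N) (f : MultiTime N → ℂ) : MultiTime N → ℂ :=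
  fun t => fderiv ℝ f t (Pi.single j 1)

/-- The mixed partial derivative `f_I`. -/
def multiDeriv {N : ℕ} (I : MultiIndex N) (f : MultiTime N → ℂ) : MultiTime N → ℂ :=
  (List.finRange N).foldr (fun j g => (partialDeriv j)^[I j] g) f

/-- The jet `(u_I(t))_I` of the field `u` at `t`. -/
def jet {N : ℕ} (u : MultiTime N → ℂ) (t : MultiTime N) : Jet N :=
  fun I => multiDeriv I u t

/-- `F` is a function `F[u]` of the field and finitely many of its partial derivatives that is
smooth (in the real sense; holomorphic dependence is a special case) around each jet in `A`.
Away from `A` the function `F` need not be smooth, so that `F` may have singularities there. -/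
def IsDifferentialFunctionOn {N : ℕ} {W : Type*} [NormedAddCommGroup W] [NormedSpace ℝ W]
    (F : Jet N → W) (A : Set (Jet N)) : Prop :=
  ∃ (S : Finset (MultiIndex N)) (f : (S → ℂ) → W),
    (∀ x : Jet N, F x = f (fun I => x I)) ∧
    ∀ x ∈ A, ContDiffAt ℝ ∞ f (fun I => x I)

/-! ### The variational bicomplex -/

/-- The partial derivative `∂F/∂u_I` at the jet `x`, as the linear map that sends a change of
`u_I` to the corresponding change of `F`. If `F` is holomorphic in `u_I`, this is multiplication
by the complex derivative. -/
def jetPartial {N : ℕ} {W : Type*} [NormedAddCommGroup W] [NormedSpace ℝ W]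
    (I : MultiIndex N) (F : Jet N → W) (x : Jet N) : ℂ →L[ℝ] W :=
  fderiv ℝ (fun z : ℂ => F (Function.update x I z)) (x I)

/-- The total derivative `D_{t_j} F = ∑_I (∂F/∂u_I) u_{I t_j}`. The sum is finite if `F` depends
on finitely many `u_I`. -/
def totalDeriv {N : ℕ} {W : Type*} [NormedAddCommGroup W] [NormedSpace ℝ W]
    (j : Fin N) (F : Jet N → W) (x : Jet N) : W :=
  ∑ᶠ I : MultiIndex N, jetPartial I F x (x (I + Pi.single j 1))

/-- `(0,b)`-forms `∑ L_{j_1 … j_b}[u] dt_{j_1} ∧ … ∧ dt_{j_b}`, with the coefficients at each jet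
gathered into one alternating map. -/
abbrev Form0 (N b : ℕ) : Type := Jet N → HCovector N b

/-- `(1,b)`-forms `∑_I δu_I ∧ θ_I`, the sum being over finitely many `I`, where `θ_I` collects the
terms `f dt_{j_1} ∧ … ∧ dt_{j_b}` that belong to `δu_I`. The coefficient of `δu_I` at a jet is
recorded as a real-linear map in the value of `δu_I`: the term `f δu_I ∧ dt_J` with a function `f`
is the map `z ↦ (f z) dt_J`, and a term in the conjugate of `δu_I` is allowed as well. -/
abbrev Form1 (N b : ℕ) : Type := MultiIndex N →₀ (Jet N → ℂ →L[ℝ] HCovector N b)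

/-- All coefficients of the `(1,b)`-form are differential functions, smooth around `A`. -/
def Form1.IsSmoothOn {N b : ℕ} (Θ : Form1 N b) (A : Set (Jet N)) : Prop :=
  ∀ I, IsDifferentialFunctionOn (Θ I) A

/-- The operator `dt_j ∧ ·`. -/
def dtWedge {N b : ℕ} (j : Fin N) : HCovector N b →L[ℝ] HCovector N (b + 1) :=
  ContinuousAlternatingMap.alternatizeUncurryFinCLM ℝ (MultiTime N) ℂ ∘L
    ContinuousLinearMap.smulRightL ℝ (MultiTime N) (HCovector N b)
      (ContinuousLinearMap.proj (R := ℝ) (φ := fun _ : Fin N => ℝ) j)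

/-- The coefficient of `δu_I` in the vertical derivative
`δ𝓛 = ∑_I ∑_J (∂L_J/∂u_I) δu_I ∧ dt_J` of a `(0,b)`-form, at the jet `x`. -/
def vertD {N b : ℕ} (L : Form0 N b) (I : MultiIndex N) (x : Jet N) : ℂ →L[ℝ] HCovector N b :=
  jetPartial I L x

/-- The coefficient of `δu_I` in the horizontal derivative `dΘ` of a `(1,b)`-form, at the jet `x`.
From `d(δu_I) = - ∑_j δu_{I t_j} ∧ dt_j` and the antiderivation property one has
`d(f δu_I ∧ dt_J) = - ∑_j (D_{t_j} f) δu_I ∧ dt_j ∧ dt_J - ∑_j f δu_{I t_j} ∧ dt_j ∧ dt_J`. -/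
def horizD {N b : ℕ} (Θ : Form1 N b) (I : MultiIndex N) (x : Jet N) :
    ℂ →L[ℝ] HCovector N (b + 1) :=
  -∑ j : Fin N, dtWedge j ∘L
    (totalDeriv j (Θ I) x + if I j = 0 then 0 else Θ (I - Pi.single j 1) x)

/-! ### Oriented surfaces in multi-time and integration of forms over them -/

/-- The half-space `{y | y_0 ≥ 0}` of `ℝ^(k+1)`. -/
def halfSpace (k : ℕ) : Set (Fin (k + 1) → ℝ) := {y | 0 ≤ y 0}

/-- A smooth coordinate patch (local parametrization) of the set `M ⊆ ℝ^N` by the relatively open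
subset `dom ∩ halfSpace k` of the half-space. -/
structure Patch (k : ℕ) {N : ℕ} (M : Set (MultiTime N)) where
  dom : Set (Fin (k + 1) → ℝ)
  isOpen_dom : IsOpen dom
  map : (Fin (k + 1) → ℝ) → MultiTime N
  contDiffOn : ContDiffOn ℝ ∞ map dom
  immersion : ∀ y ∈ dom ∩ halfSpace k, Function.Injective (fderiv ℝ map y)
  embedding : Topology.IsEmbedding ((dom ∩ halfSpace k).domRestrict map)
  image_open : ∃ W : Set (MultiTime N), IsOpen W ∧ map '' (dom ∩ halfSpace k) = M ∩ W

namespace Patch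

variable {k N : ℕ} {M : Set (MultiTime N)}

/-- The part of `M` covered by the patch. -/
def image (φ : Patch k M) : Set (MultiTime N) := φ.map '' (φ.dom ∩ halfSpace k)

/-- The coordinate frame `∂φ/∂y_0, …, ∂φ/∂y_k` at the parameter `y`. -/
def frame (φ : Patch k M) (y : Fin (k + 1) → ℝ) : Fin (k + 1) → MultiTime N :=
  fun i => fderiv ℝ φ.map y (Pi.single i 1)

end Patch

/-- An oriented smooth `(k+1)`-dimensional submanifold `Γ` of `ℝ^N`, possibly with boundary.
The orientation is given by a continuous field of alternating forms that does not vanish on the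
tangent spaces of `Γ`; a frame of a tangent space is positive if the form is positive on it. -/
structure Surface (k N : ℕ) where
  carrier : Set (MultiTime N)
  exists_patch : ∀ p ∈ carrier, ∃ φ : Patch k carrier, p ∈ φ.image
  orientation : MultiTime N → (MultiTime N) [⋀^Fin (k + 1)]→L[ℝ] ℝ
  continuousOn_orientation : ContinuousOn orientation carrier
  orientation_ne_zero : ∀ φ : Patch k carrier, ∀ y ∈ φ.dom ∩ halfSpace k,
    orientation (φ.map y) (φ.frame y) ≠ 0

namespace Surface

variable {k N : ℕ}

/-- The (manifold) boundary `∂Γ`. -/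
def boundary (Γ : Surface k N) : Set (MultiTime N) :=
  {p | ∃ φ : Patch k Γ.carrier, ∃ y ∈ φ.dom, y 0 = 0 ∧ φ.map y = p}

/-- A partition of unity on `Γ` with compact supports, subordinate to coordinate patches. -/
structure Partition (Γ : Surface k N) where
  ι : Type
  patch : ι → Patch k Γ.carrier
  weight : ι → MultiTime N → ℝ
  continuousOn : ∀ i, ContinuousOn (weight i) Γ.carrier
  nonneg : ∀ i, ∀ p ∈ Γ.carrier, 0 ≤ weight i p
  compact_support : ∀ i, ∃ K : Set (MultiTime N), IsCompact K ∧ K ⊆ (patch i).image ∧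
    ∀ p ∈ Γ.carrier, p ∉ K → weight i p = 0
  locallyFinite : ∀ p ∈ Γ.carrier, ∃ W ∈ 𝓝 p,
    {i | ∃ q ∈ Γ.carrier ∩ W, weight i q ≠ 0}.Finite
  sum_eq_one : ∀ p ∈ Γ.carrier, ∑ᶠ i, weight i p = 1

theorem nonempty_partition (Γ : Surface k N) : Nonempty Γ.Partition := by
  classical
  choose φ hφ using Γ.exists_patch
  have key : ∀ p : Γ.carrier, ∃ V : Set Γ.carrier, IsOpen V ∧ p ∈ V ∧
      ∃ K : Set (MultiTime N), IsCompact K ∧ K ⊆ (φ p p.2).image ∧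
        ∀ q ∈ V, (q : MultiTime N) ∈ K := by
    intro p
    obtain ⟨y, ⟨hyd, hyH⟩, hyp⟩ := hφ p p.2
    obtain ⟨r, hr, hball⟩ := Metric.nhds_basis_closedBall.mem_iff.1
      ((φ p p.2).isOpen_dom.mem_nhds hyd)
    obtain ⟨W, hW, hWim⟩ := (φ p p.2).image_open
    obtain ⟨W', hW', hpre⟩ := (φ p p.2).embedding.isInducing.isOpen_iff.1
      ((Metric.isOpen_ball (x := y) (ε := r)).preimage continuous_subtype_val)
    have hH : IsClosed (halfSpace k) := isClosed_le continuous_const (continuous_apply 0)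
    refine ⟨Subtype.val ⁻¹' (W ∩ W'), (hW.inter hW').preimage continuous_subtype_val, ⟨?_, ?_⟩,
      (φ p p.2).map '' (Metric.closedBall y r ∩ halfSpace k), ?_, ?_, ?_⟩
    · exact (hWim.le ⟨y, ⟨hyd, hyH⟩, hyp⟩).2
    · have : (⟨y, hyd, hyH⟩ : ↥((φ p p.2).dom ∩ halfSpace k)) ∈
          ((φ p p.2).dom ∩ halfSpace k).domRestrict (φ p p.2).map ⁻¹' W' := by
        rw [hpre]; exact Metric.mem_ball_self hr
      have h2 : (φ p p.2).map y ∈ W' := this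
      rwa [hyp] at h2
    · exact ((isCompact_closedBall y r).inter_right hH).image_of_continuousOn
        ((φ p p.2).contDiffOn.continuousOn.mono (Set.inter_subset_left.trans hball))
    · exact Set.image_mono (Set.inter_subset_inter_left _ hball)
    · rintro q ⟨hqW, hqW'⟩
      obtain ⟨z, hz, hzq⟩ := hWim.ge ⟨q.2, hqW⟩
      have : (⟨z, hz⟩ : ↥((φ p p.2).dom ∩ halfSpace k)) ∈
          ((φ p p.2).dom ∩ halfSpace k).domRestrict (φ p p.2).map ⁻¹' W' := by
        change (φ p p.2).map z ∈ W'
        rwa [hzq]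
      rw [hpre] at this
      exact ⟨z, ⟨Metric.ball_subset_closedBall this, hz.2⟩, hzq⟩
  choose V hVo hpV K hK hKim hVK using key
  obtain ⟨f, hf⟩ := PartitionOfUnity.exists_isSubordinate isClosed_univ V hVo
    (fun p _ => Set.mem_iUnion.2 ⟨p, hpV p⟩)
  have hw : ∀ (i : Γ.carrier) (p : MultiTime N) (hp : p ∈ Γ.carrier),
      (if h : p ∈ Γ.carrier then f i ⟨p, h⟩ else 0) = f i ⟨p, hp⟩ := fun i p hp => dif_pos hp
  refine ⟨{ ι := Γ.carrier
            patch := fun i => φ i i.2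
            weight := fun i p => if h : p ∈ Γ.carrier then f i ⟨p, h⟩ else 0
            continuousOn := fun i => ?_
            nonneg := fun i p hp => ?_
            compact_support := fun i => ⟨K i, hK i, hKim i, fun p hp hpK => ?_⟩
            locallyFinite := fun p hp => ?_
            sum_eq_one := fun p hp => ?_ }⟩
  · rw [continuousOn_iff_continuous_domRestrict]
    refine (f i).continuous.congr fun p => ?_
    exact (hw i p p.2).symm
  · rw [hw i p hp]; exact f.nonneg i _
  · rw [hw i p hp]
    by_contra hne
    exact hpK (hVK i ⟨p, hp⟩ (hf i (subset_tsupport _ hne)))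
  · obtain ⟨T, hT, hfin⟩ := f.locallyFinite ⟨p, hp⟩
    obtain ⟨W, hW, hWT⟩ := mem_nhds_subtype _ _ _ |>.1 hT
    refine ⟨W, hW, hfin.subset ?_⟩
    rintro i ⟨q, ⟨hq, hqW⟩, hne⟩
    rw [hw i q hq] at hne
    exact ⟨⟨q, hq⟩, hne, hWT hqW⟩
  · simp only [hw _ p hp]
    exact f.sum_eq_one (Set.mem_univ _)

/-- The integral `∫_Γ η` of a `(k+1)`-form `η` whose support in `Γ` is compact (any `η` if `Γ` is
compact): with a partition of unity `ρ_i` subordinate to patches `φ_i`, it is the sum over `i` of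
`± ∫ φ_i^* (ρ_i η)`, the sign being `+` where `φ_i` is compatible with the orientation and `-` where
it is not. The value for continuous `η` does not depend on the partition of unity. -/
def integral (Γ : Surface k N) (η : MultiTime N → HCovector N (k + 1)) : ℂ :=
  let P : Γ.Partition := Classical.choice Γ.nonempty_partition
  ∑ᶠ i, ∫ y in (P.patch i).dom ∩ halfSpace k,
    ((SignType.sign (Γ.orientation ((P.patch i).map y) ((P.patch i).frame y)) : ℝ) *
        P.weight i ((P.patch i).map y)) •
      η ((P.patch i).map y) ((P.patch i).frame y)

end Surface

/-! ### Critical fields -/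

/-- The field `u` is a critical point of the action `S_Γ[u] = ∫_Γ 𝓛[u]` with respect to variations
`v` that are zero near the boundary of `Γ`: the derivative of `S_Γ[u + ε v]` at `ε = 0` vanishes.
As `Γ` may be non-compact, the support of `v` in `Γ` has to be compact, and the (possibly infinite)
constant `S_Γ[u]` is subtracted under the integral sign. If `Γ` is compact, then the first is
automatic and the function to be differentiated is `S_Γ[u + ε v] - S_Γ[u]`. -/
def IsCriticalPoint {k N : ℕ} (Γ : Surface k N) (L : Form0 N (k + 1)) (u : MultiTime N → ℂ) :
    Prop :=
  ∀ v : MultiTime N → ℂ, ContDiff ℝ ∞ v → (∀ᶠ t in 𝓝ˢ Γ.boundary, v t = 0) →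
    IsCompact (Γ.carrier ∩ tsupport v) →
    HasDerivAt
      (fun ε : ℝ => Γ.integral fun t => L (jet (fun s => u s + ε * v s) t) - L (jet u t)) 0 0

end PluriLagrangian

end

noncomputable section

namespace PluriLagrangian

/-! ### Jets of smooth functions -/

section Jets

variable {N : ℕ}

/-! Inserting a variation `v` into `Θ` along `u` gives an ordinary form on multi-time, `ω = ∑_I
θ_I[u](v_I)` (`contractForm`). By the product rule, `dω` has two kinds of terms: a total derivative
of a coefficient paired with `v_I`, and a coefficient paired with `v_{I t_j}`. These are exactly the
two sums in the horizontal derivative, up to the sign from moving `dt_j` past `δu_I`. Hence the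
hypothesis `δ𝓛 = dΘ` says that the linearization of `𝓛` at `u` in the direction `v` is `-dω`
(`fderiv_eq_neg_extDeriv_contractForm`).

The form `ω` is supported in the support of `v`, so it vanishes near `∂Γ` and its support meets `Γ`
in a compact set. Stokes' theorem (`Surface.integral_extDeriv_eq_zero`) then gives `∫_Γ dω = 0`. The
same compactness permits differentiation under the integral (`Surface.hasDerivAt_integral`),
although `𝓛` is smooth only around the jets of `u`.

The integral is defined by one fixed partition of unity, so Stokes cannot be read off chart by
chart. A form supported in the interior of one patch is first moved to that patch by change of
variables (`Surface.setIntegral_density_eq`); there the claim is that a compactly supported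
derivative has integral zero. A second, smooth partition of unity on `ℝ^N` reduces the general case
to this one. Since all forms vanish on `∂Γ`, no boundary term is ever computed. -/

theorem contDiff_partialDeriv {f : MultiTime N → ℂ} (hf : ContDiff ℝ ∞ f) (j : Fin N) :
    ContDiff ℝ ∞ (partialDeriv j f) :=
  (hf.fderiv_right (m := ∞) (by simp)).clm_apply contDiff_const

theorem contDiff_iterate_partialDeriv {f : MultiTime N → ℂ} (hf : ContDiff ℝ ∞ f) (j : Fin N)
    (n : ℕ) : ContDiff ℝ ∞ ((partialDeriv j)^[n] f) := by
  induction n with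
  | zero => simpa using hf
  | succ n ih =>
    rw [Function.iterate_succ_apply']
    exact contDiff_partialDeriv ih j

theorem contDiff_foldr_partialDeriv {f : MultiTime N → ℂ} (hf : ContDiff ℝ ∞ f)
    (I : MultiIndex N) (l : List (Fin N)) :
    ContDiff ℝ ∞ (l.foldr (fun j g => (partialDeriv j)^[I j] g) f) := by
  induction l with
  | nil => simpa using hf
  | cons a l ih => exact contDiff_iterate_partialDeriv ih a _

theorem contDiff_multiDeriv {f : MultiTime N → ℂ} (hf : ContDiff ℝ ∞ f) (I : MultiIndex N) :
    ContDiff ℝ ∞ (multiDeriv I f) :=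
  contDiff_foldr_partialDeriv hf I _

theorem partialDeriv_comm {f : MultiTime N → ℂ} (hf : ContDiff ℝ ∞ f) (i j : Fin N) :
    partialDeriv i (partialDeriv j f) = partialDeriv j (partialDeriv i f) := by
  have hd : Differentiable ℝ (fderiv ℝ f) :=
    (hf.fderiv_right (m := ∞) (by simp)).differentiable (by simp)
  have key : ∀ (a b : Fin N) (t : MultiTime N), partialDeriv a (partialDeriv b f) t =
      fderiv ℝ (fderiv ℝ f) t (Pi.single a 1) (Pi.single b 1) := fun a b t => by
    change fderiv ℝ (fun s => fderiv ℝ f s (Pi.single b 1)) t (Pi.single a 1) = _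
    rw [fderiv_clm_apply (hd t) (differentiableAt_const _)]
    simp
  ext t
  rw [key, key]
  exact second_derivative_symmetric (fun y => (hf.differentiable (by simp) y).hasFDerivAt)
    (hd t).hasFDerivAt _ _

theorem partialDeriv_iterate_comm {f : MultiTime N → ℂ} (hf : ContDiff ℝ ∞ f) (i j : Fin N)
    (n : ℕ) : partialDeriv i ((partialDeriv j)^[n] f) = (partialDeriv j)^[n] (partialDeriv i f) := by
  induction n with
  | zero => rfl
  | succ n ih =>
    rw [Function.iterate_succ_apply', Function.iterate_succ_apply',
      partialDeriv_comm (contDiff_iterate_partialDeriv hf j n), ih]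

theorem foldr_partialDeriv_congr {f : MultiTime N → ℂ} {I I' : MultiIndex N}
    {l : List (Fin N)} (h : ∀ j ∈ l, I j = I' j) :
    l.foldr (fun j g => (partialDeriv j)^[I j] g) f =
      l.foldr (fun j g => (partialDeriv j)^[I' j] g) f := by
  induction l with
  | nil => rfl
  | cons a l ih =>
    simp only [List.foldr_cons]
    rw [ih fun j hj => h j (List.mem_cons_of_mem _ hj), h a List.mem_cons_self]

/-- A new `∂_j` commutes inwards past the other directions until it meets the block of `∂_j`. The
list has no duplicates, so this block occurs once and no other exponent changes. -/
theorem partialDeriv_foldr {f : MultiTime N → ℂ} (hf : ContDiff ℝ ∞ f) (I : MultiIndex N)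
    (j : Fin N) {l : List (Fin N)} (hl : l.Nodup) (hj : j ∈ l) :
    partialDeriv j (l.foldr (fun j g => (partialDeriv j)^[I j] g) f) =
      l.foldr (fun i g => (partialDeriv i)^[(I + Pi.single j 1 : MultiIndex N) i] g) f := by
  induction l with
  | nil => simp at hj
  | cons a l ih =>
    rw [List.nodup_cons] at hl
    simp only [List.foldr_cons]
    by_cases haj : a = j
    · subst haj
      rw [foldr_partialDeriv_congr (I := I + Pi.single a 1) (I' := I)]
      · simp [Function.iterate_succ_apply']
      · intro i hi
        have : i ≠ a := fun h => hl.1 (h ▸ hi)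
        simp [this]
    · have hj' : j ∈ l := (List.mem_cons.1 hj).resolve_left (Ne.symm haj)
      rw [partialDeriv_iterate_comm (contDiff_foldr_partialDeriv hf I l), ih hl.2 hj']
      simp [haj]

theorem partialDeriv_multiDeriv {f : MultiTime N → ℂ} (hf : ContDiff ℝ ∞ f) (I : MultiIndex N)
    (j : Fin N) : partialDeriv j (multiDeriv I f) = multiDeriv (I + Pi.single j 1) f :=
  partialDeriv_foldr hf I j (List.nodup_finRange N) (List.mem_finRange j)

theorem fderiv_multiDeriv {f : MultiTime N → ℂ} (hf : ContDiff ℝ ∞ f) (I : MultiIndex N)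
    (j : Fin N) (t : MultiTime N) :
    fderiv ℝ (multiDeriv I f) t (Pi.single j 1) = jet f t (I + Pi.single j 1) :=
  congrFun (partialDeriv_multiDeriv hf I j) t

theorem partialDeriv_add_smul {f g : MultiTime N → ℂ} (hf : ContDiff ℝ ∞ f)
    (hg : ContDiff ℝ ∞ g) (ε : ℝ) (j : Fin N) :
    partialDeriv j (fun s => f s + ε * g s) =
      fun s => partialDeriv j f s + ε * partialDeriv j g s := by
  ext t
  have hf' := hf.differentiable (by simp) t
  have hg' := hg.differentiable (by simp) t
  simp only [partialDeriv]
  rw [fderiv_fun_add hf' (hg'.const_mul _), fderiv_const_mul hg']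
  simp

theorem iterate_partialDeriv_add_smul {f g : MultiTime N → ℂ} (hf : ContDiff ℝ ∞ f)
    (hg : ContDiff ℝ ∞ g) (ε : ℝ) (j : Fin N) (n : ℕ) :
    (partialDeriv j)^[n] (fun s => f s + ε * g s) =
      fun s => (partialDeriv j)^[n] f s + ε * (partialDeriv j)^[n] g s := by
  induction n with
  | zero => rfl
  | succ n ih =>
    simp only [Function.iterate_succ_apply', ih]
    exact partialDeriv_add_smul (contDiff_iterate_partialDeriv hf j n)
      (contDiff_iterate_partialDeriv hg j n) ε j

theorem jet_add_smul {f g : MultiTime N → ℂ} (hf : ContDiff ℝ ∞ f) (hg : ContDiff ℝ ∞ g)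
    (ε : ℝ) (t : MultiTime N) (I : MultiIndex N) :
    jet (fun s => f s + ε * g s) t I = jet f t I + ε * jet g t I := by
  suffices h : ∀ l : List (Fin N),
      l.foldr (fun j g => (partialDeriv j)^[I j] g) (fun s => f s + ε * g s) =
        fun s => l.foldr (fun j g => (partialDeriv j)^[I j] g) f s +
          ε * l.foldr (fun j g => (partialDeriv j)^[I j] g) g s from congrFun (h _) t
  intro l
  induction l with
  | nil => rfl
  | cons a l ih =>
    simp only [List.foldr_cons, ih]
    exact iterate_partialDeriv_add_smul (contDiff_foldr_partialDeriv hf I l)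
      (contDiff_foldr_partialDeriv hg I l) ε a (I a)

theorem partialDeriv_eventuallyEq_zero {f : MultiTime N → ℂ} {t : MultiTime N} (j : Fin N)
    (hf : f =ᶠ[𝓝 t] 0) : partialDeriv j f =ᶠ[𝓝 t] 0 := by
  filter_upwards [hf.fderiv (𝕜 := ℝ)] with s hs
  simp [partialDeriv, hs]

/-- Vanishing has to be carried as a property of germs: unlike vanishing at a point, it survives
differentiation. -/
theorem multiDeriv_eventuallyEq_zero {f : MultiTime N → ℂ} {t : MultiTime N} (I : MultiIndex N)
    (hf : f =ᶠ[𝓝 t] 0) : multiDeriv I f =ᶠ[𝓝 t] 0 := by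
  suffices h : ∀ l : List (Fin N),
      l.foldr (fun j g => (partialDeriv j)^[I j] g) f =ᶠ[𝓝 t] 0 from h _
  intro l
  induction l with
  | nil => exact hf
  | cons a l ih =>
    simp only [List.foldr_cons]
    induction I a with
    | zero => exact ih
    | succ n ihn =>
      rw [Function.iterate_succ_apply']
      exact partialDeriv_eventuallyEq_zero a ihn

theorem jet_eventuallyEq_zero {f : MultiTime N → ℂ} {t : MultiTime N} (I : MultiIndex N)
    (ht : t ∉ tsupport f) : (fun s => jet f s I) =ᶠ[𝓝 t] 0 :=
  multiDeriv_eventuallyEq_zero I (notMem_tsupport_iff_eventuallyEq.1 ht)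

end Jets

end PluriLagrangian
end

noncomputable section

namespace PluriLagrangian

/-! ### Derivatives of differential functions along jets -/

section JetCalculus

variable {N : ℕ} {W : Type*} [NormedAddCommGroup W] [NormedSpace ℝ W]

/-- The finitely many jet coordinates indexed by `S`. -/
def jetRestrict (S : Finset (MultiIndex N)) (x : Jet N) : S → ℂ := fun I => x I

/-- The inclusion of the coordinate `u_I` into the jet coordinates indexed by `S`. -/
def coordInclusion (S : Finset (MultiIndex N)) (I : MultiIndex N) : ℂ →L[ℝ] (S → ℂ) :=
  ContinuousLinearMap.pi fun J => if (J : MultiIndex N) = I then ContinuousLinearMap.id ℝ ℂ else 0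

theorem hasFDerivAt_jetRestrict_update (S : Finset (MultiIndex N)) (x : Jet N)
    (I : MultiIndex N) :
    HasFDerivAt (𝕜 := ℝ) (fun z : ℂ => jetRestrict S (Function.update x I z))
      (coordInclusion S I) (x I) := by
  refine hasFDerivAt_pi.2 fun J => ?_
  by_cases h : (J : MultiIndex N) = I
  · simp only [jetRestrict, h, Function.update_self, if_true]
    exact hasFDerivAt_id _
  · simp only [jetRestrict, h, Function.update_of_ne, ne_eq, not_false_eq_true, if_false]
    exact hasFDerivAt_const _ _

variable {F : Jet N → W} {S : Finset (MultiIndex N)} {f : (S → ℂ) → W} {x : Jet N}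

theorem jetPartial_eq_comp (hF : ∀ x, F x = f (jetRestrict S x))
    (hf : DifferentiableAt ℝ f (jetRestrict S x)) (I : MultiIndex N) :
    jetPartial I F x = (fderiv ℝ f (jetRestrict S x)).comp (coordInclusion S I) := by
  have h1 : HasFDerivAt f (fderiv ℝ f (jetRestrict S x))
      (jetRestrict S (Function.update x I (x I))) := by
    rw [Function.update_eq_self]; exact hf.hasFDerivAt
  have h2 := h1.comp (x I) (hasFDerivAt_jetRestrict_update S x I)
  rw [jetPartial]
  simp only [hF]
  exact h2.fderiv

theorem sum_coordInclusion {T : Finset (MultiIndex N)} (hST : S ⊆ T) (y : Jet N) :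
    ∑ I ∈ T, coordInclusion S I (y I) = jetRestrict S y := by
  ext J
  rw [Finset.sum_apply, Finset.sum_eq_single (J : MultiIndex N)]
  · simp [coordInclusion, jetRestrict]
  · intro I _ hI
    simp [coordInclusion, hI.symm]
  · exact fun h => absurd (hST J.2) h

/-- Coordinates outside `S` contribute nothing, so the index set may be enlarged at will. This
freedom allows `δ𝓛` and `dΘ` to be summed over a common finite set. -/
theorem sum_jetPartial (hF : ∀ x, F x = f (jetRestrict S x))
    (hf : DifferentiableAt ℝ f (jetRestrict S x)) {T : Finset (MultiIndex N)} (hST : S ⊆ T)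
    (y : Jet N) :
    ∑ I ∈ T, jetPartial I F x (y I) = fderiv ℝ f (jetRestrict S x) (jetRestrict S y) := by
  simp only [jetPartial_eq_comp hF hf, ContinuousLinearMap.comp_apply]
  rw [← map_sum, sum_coordInclusion hST]

theorem totalDeriv_eq (hF : ∀ x, F x = f (jetRestrict S x))
    (hf : DifferentiableAt ℝ f (jetRestrict S x)) (j : Fin N) :
    totalDeriv j F x =
      fderiv ℝ f (jetRestrict S x) (jetRestrict S fun I => x (I + Pi.single j 1)) := by
  rw [totalDeriv, finsum_eq_sum_of_support_subset (s := S)]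
  · exact sum_jetPartial hF hf subset_rfl fun I => x (I + Pi.single j 1)
  intro I hI
  by_contra hIS
  refine hI ?_
  have : coordInclusion S I (x (I + Pi.single j 1)) = 0 := by
    ext J
    have : (J : MultiIndex N) ≠ I := fun h => hIS (h ▸ J.2)
    simp [coordInclusion, this]
  simp [jetPartial_eq_comp hF hf, this]

theorem contDiff_jetRestrict_jet {u : MultiTime N → ℂ} (hu : ContDiff ℝ ∞ u)
    (S : Finset (MultiIndex N)) : ContDiff ℝ ∞ fun t => jetRestrict S (jet u t) :=
  contDiff_pi.2 fun I => contDiff_multiDeriv hu I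

theorem fderiv_jetRestrict_jet {u : MultiTime N → ℂ} (hu : ContDiff ℝ ∞ u)
    (S : Finset (MultiIndex N)) (t : MultiTime N) (j : Fin N) :
    fderiv ℝ (fun t => jetRestrict S (jet u t)) t (Pi.single j 1) =
      jetRestrict S fun I => jet u t (I + Pi.single j 1) := by
  ext I
  have h := fderiv_multiDeriv hu I j t
  have h2 := fderiv_pi (𝕜 := ℝ) (x := t) (φ := fun (I : S) t => multiDeriv (I : MultiIndex N) u t)
    fun I => (contDiff_multiDeriv hu I).differentiable (by simp) t
  exact (congrFun (congrArg (fun A => A (Pi.single j 1)) h2) I).trans h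

/-- A differential function is smooth along the jets of a smooth field. -/
theorem IsDifferentialFunctionOn.contDiff_comp_jet {u : MultiTime N → ℂ} (hu : ContDiff ℝ ∞ u)
    (hF : IsDifferentialFunctionOn F (Set.range (jet u))) : ContDiff ℝ ∞ fun t => F (jet u t) := by
  obtain ⟨S, f, hFf, hf⟩ := hF
  refine contDiff_iff_contDiffAt.2 fun t => ?_
  simp only [hFf]
  exact (hf _ ⟨t, rfl⟩).comp t (contDiff_jetRestrict_jet hu S).contDiffAt

/-- The total derivative computes the partial derivatives along a field. -/
theorem IsDifferentialFunctionOn.fderiv_comp_jet {u : MultiTime N → ℂ} (hu : ContDiff ℝ ∞ u)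
    (hF : IsDifferentialFunctionOn F (Set.range (jet u))) (t : MultiTime N) (j : Fin N) :
    fderiv ℝ (fun t => F (jet u t)) t (Pi.single j 1) = totalDeriv j F (jet u t) := by
  obtain ⟨S, f, hFf, hf⟩ := hF
  have hd : DifferentiableAt ℝ f (jetRestrict S (jet u t)) :=
    (hf _ ⟨t, rfl⟩).differentiableAt (by simp)
  rw [totalDeriv_eq hFf hd, ← fderiv_jetRestrict_jet hu]
  simp only [hFf]
  exact congrArg (fun A => A (Pi.single j 1)) (fderiv_comp t hd
    ((contDiff_jetRestrict_jet hu S).differentiable (by simp) t))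

theorem totalDeriv_zero (j : Fin N) (x : Jet N) : totalDeriv j (0 : Jet N → W) x = 0 := by
  simp [totalDeriv, jetPartial]

end JetCalculus

/-! ### The horizontal derivative along a variation -/

section HorizontalDerivative

variable {N b : ℕ}

/-- The `b`-form `∑_I θ_I[u](v_I)` obtained by inserting the variation `v` into
`Θ = ∑_I δu_I ∧ θ_I` along the field `u`. -/
def contractForm (Θ : Form1 N b) (u v : MultiTime N → ℂ) (t : MultiTime N) : HCovector N b :=
  ∑ I ∈ Θ.support, Θ I (jet u t) (jet v t I)

theorem contDiff_contractForm {Θ : Form1 N b} {u v : MultiTime N → ℂ} (hu : ContDiff ℝ ∞ u)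
    (hv : ContDiff ℝ ∞ v) (hΘ : Θ.IsSmoothOn (Set.range (jet u))) :
    ContDiff ℝ ∞ (contractForm Θ u v) :=
  ContDiff.sum fun I _ => ((hΘ I).contDiff_comp_jet hu).clm_apply (contDiff_multiDeriv hv I)

theorem contractForm_eventuallyEq_zero (Θ : Form1 N b) (u : MultiTime N → ℂ)
    {v : MultiTime N → ℂ} {t : MultiTime N} (ht : t ∉ tsupport v) :
    contractForm Θ u v =ᶠ[𝓝 t] 0 := by
  have := (Filter.eventually_all_finset Θ.support).2 fun I _ => jet_eventuallyEq_zero I ht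
  filter_upwards [this] with s hs
  exact Finset.sum_eq_zero fun I hI => by simpa using congrArg (Θ I (jet u s)) (hs I hI)

/-- The product rule: differentiating the coefficient gives the total derivative, differentiating
`v_I` shifts the index. -/
theorem fderiv_contractForm {Θ : Form1 N b} {u v : MultiTime N → ℂ} (hu : ContDiff ℝ ∞ u)
    (hv : ContDiff ℝ ∞ v) (hΘ : Θ.IsSmoothOn (Set.range (jet u))) (t : MultiTime N) (j : Fin N) :
    fderiv ℝ (contractForm Θ u v) t (Pi.single j 1) =
      ∑ I ∈ Θ.support, (totalDeriv j (Θ I) (jet u t) (jet v t I) +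
        Θ I (jet u t) (jet v t (I + Pi.single j 1))) := by
  have h1 : ∀ I, DifferentiableAt ℝ (fun t => Θ I (jet u t)) t := fun I =>
    ((hΘ I).contDiff_comp_jet hu).differentiable (by simp) t
  have h2 : ∀ I, DifferentiableAt ℝ (fun t => jet v t I) t := fun I =>
    (contDiff_multiDeriv hv I).differentiable (by simp) t
  have : contractForm Θ u v = fun t => ∑ I ∈ Θ.support, Θ I (jet u t) (jet v t I) := rfl
  rw [this, fderiv_fun_sum fun I _ => (h1 I).clm_apply (h2 I), sum_apply]
  refine Finset.sum_congr rfl fun I _ => ?_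
  rw [fderiv_clm_apply (h1 I) (h2 I), ← (hΘ I).fderiv_comp_jet hu, ← fderiv_multiDeriv hv]
  simp [add_comm, jet]

/-- Expanding the argument of the Fréchet derivative in coordinates writes it as `∑_j dt_j ⊗ ∂_j η`,
and alternatization is linear. -/
theorem extDeriv_eq_sum_dtWedge (η : MultiTime N → HCovector N b) (t : MultiTime N) :
    extDeriv η t = ∑ j, dtWedge j (fderiv ℝ η t (Pi.single j 1)) := by
  have h : fderiv ℝ η t = ∑ j, (ContinuousLinearMap.proj (R := ℝ)
      (φ := fun _ : Fin N => ℝ) j).smulRight (fderiv ℝ η t (Pi.single j 1)) := by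
    refine ContinuousLinearMap.ext fun z => ?_
    conv_lhs => rw [pi_eq_sum_univ' z]
    simp [sum_apply]
  rw [extDeriv, ← ContinuousAlternatingMap.alternatizeUncurryFinCLM_apply]
  conv_lhs => rw [h]
  rw [map_sum]
  rfl

/-- Summation by shifting the index: the substitution `I ↦ I + e_j` moves the second sum of `dΘ`
back to the support of `Θ`. For this, `T` has to contain the shifted indices too. -/
theorem sum_horizD (Θ : Form1 N b) (x y : Jet N) {T : Finset (MultiIndex N)}
    (hT : Θ.support ⊆ T) (hT' : ∀ I ∈ Θ.support, ∀ j, I + Pi.single j 1 ∈ T) :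
    ∑ I ∈ T, horizD Θ I x (y I) = -∑ j, dtWedge j (∑ I ∈ Θ.support,
      (totalDeriv j (Θ I) x (y I) + Θ I x (y (I + Pi.single j 1)))) := by
  have h1 : ∀ j : Fin N, ∑ I ∈ T, totalDeriv j (Θ I) x (y I) =
      ∑ I ∈ Θ.support, totalDeriv j (Θ I) x (y I) := fun j =>
    (Finset.sum_subset hT fun I _ hI => by
      rw [Finsupp.notMem_support_iff.1 hI, totalDeriv_zero]; rfl).symm
  have h2 : ∀ j : Fin N, ∑ I ∈ T, (if I j = 0 then 0 else Θ (I - Pi.single j 1) x) (y I) =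
      ∑ I ∈ Θ.support, Θ I x (y (I + Pi.single j 1)) := fun j => by
    have hinj : Set.InjOn (fun I : MultiIndex N => I + Pi.single j 1) Θ.support :=
      fun _ _ _ _ h => add_right_cancel h
    have hsub : Θ.support.image (fun I : MultiIndex N => I + Pi.single j 1) ⊆ T :=
      Finset.image_subset_iff.2 fun I hI => hT' I hI j
    rw [← Finset.sum_subset hsub, Finset.sum_image hinj]
    · refine Finset.sum_congr rfl fun I _ => ?_
      simp
    · intro I _ hI
      -- An index that is not a shift of one in the support contributes zero: if `I j = 0` by
      -- definition, and otherwise because the truncated subtraction is exact, so `I - e_j` lies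
      -- outside the support.
      split_ifs with hj
      · rfl
      · have hI' : I - Pi.single j 1 + Pi.single j 1 = I := by
          ext i
          by_cases h : i = j
          · subst h; simp; omega
          · simp [h]
        have : I - Pi.single j 1 ∉ Θ.support := fun h =>
          hI (Finset.mem_image.2 ⟨_, h, hI'⟩)
        rw [Finsupp.notMem_support_iff.1 this]; rfl
  simp only [Finset.sum_add_distrib, ← h1, ← h2]
  simp only [← Finset.sum_add_distrib, map_sum]
  rw [Finset.sum_comm, ← Finset.sum_neg_distrib]
  refine Finset.sum_congr rfl fun I _ => ?_
  simp [horizD, sum_apply]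

theorem sum_horizD_jet {Θ : Form1 N b} {u v : MultiTime N → ℂ} (hu : ContDiff ℝ ∞ u)
    (hv : ContDiff ℝ ∞ v) (hΘ : Θ.IsSmoothOn (Set.range (jet u))) (t : MultiTime N)
    {T : Finset (MultiIndex N)} (hT : Θ.support ⊆ T)
    (hT' : ∀ I ∈ Θ.support, ∀ j, I + Pi.single j 1 ∈ T) :
    ∑ I ∈ T, horizD Θ I (jet u t) (jet v t I) = -extDeriv (contractForm Θ u v) t := by
  simp only [sum_horizD Θ _ _ hT hT', extDeriv_eq_sum_dtWedge, fderiv_contractForm hu hv hΘ]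

end HorizontalDerivative

end PluriLagrangian
end

noncomputable section

namespace PluriLagrangian

/-! ### Stokes' theorem in a coordinate domain -/

section LocalStokes

open MeasureTheory

/-- Integration by parts against the constant function `1`. -/
theorem integral_fderiv_eq_zero_of_hasCompactSupport {E G : Type*} [NormedAddCommGroup E]
    [NormedSpace ℝ E] [FiniteDimensional ℝ E] [MeasurableSpace E] [BorelSpace E]
    [NormedAddCommGroup G] [NormedSpace ℝ G] (μ : Measure E) [μ.IsAddHaarMeasure] {g : E → G}
    (hg : ContDiff ℝ 1 g) (hc : HasCompactSupport g) (v : E) :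
    ∫ x, fderiv ℝ g x v ∂μ = 0 := by
  have hi : Integrable g μ := hg.continuous.integrable_of_hasCompactSupport hc
  have hi' : Integrable (fun x => fderiv ℝ g x v) μ :=
    ((hg.continuous_fderiv one_ne_zero).clm_apply
      continuous_const).integrable_of_hasCompactSupport (hc.fderiv_apply ℝ v)
  simpa using integral_smul_fderiv_eq_neg_fderiv_smul_of_integrable (μ := μ) (𝕜 := ℝ) (v := v)
    (f := fun _ : E => (1 : ℝ)) (g := g) (by simp) (by simpa using hi') (by simpa using hi)
    (fun x _ => differentiableAt_const _) (fun x _ => hg.differentiable one_ne_zero x)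

/-- The open sets `B` and the complement of `C` cover the space; the extension by zero equals `g` on
the first and `0` on the second. -/
theorem contDiff_indicator {E G : Type*} [NormedAddCommGroup E] [NormedSpace ℝ E]
    [NormedAddCommGroup G] [NormedSpace ℝ G] {B C : Set E} (hB : IsOpen B) (hC : IsClosed C)
    (hCB : C ⊆ B) {g : E → G} {n : WithTop ℕ∞} (hg : ContDiffOn ℝ n g B)
    (hg0 : ∀ y ∈ B \ C, g y = 0) : ContDiff ℝ n (C.indicator g) := by
  refine contDiff_iff_contDiffAt.2 fun y => ?_
  by_cases hy : y ∈ B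
  · refine (hg.contDiffAt (hB.mem_nhds hy)).congr_of_eventuallyEq ?_
    filter_upwards [hB.mem_nhds hy] with z hz
    by_cases hzC : z ∈ C
    · simp [hzC]
    · simp [hzC, hg0 z ⟨hz, hzC⟩]
  · refine (contDiffAt_const (c := (0 : G))).congr_of_eventuallyEq ?_
    filter_upwards [hC.isOpen_compl.mem_nhds fun h => hy (hCB h)] with z hz
    exact Set.indicator_of_notMem hz g

theorem setIntegral_fderiv_eq_zero {E G : Type*} [NormedAddCommGroup E]
    [NormedSpace ℝ E] [FiniteDimensional ℝ E] [MeasurableSpace E] [BorelSpace E]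
    [NormedAddCommGroup G] [NormedSpace ℝ G] (μ : Measure E) [μ.IsAddHaarMeasure] {B C : Set E}
    (hB : IsOpen B) (hC : IsCompact C) (hCB : C ⊆ B) {g : E → G} (hg : ContDiffOn ℝ 1 g B)
    (hg0 : ∀ y ∈ B \ C, g y = 0) (v : E) :
    IntegrableOn (fun x => fderiv ℝ g x v) B μ ∧ ∫ x in B, fderiv ℝ g x v ∂μ = 0 := by
  have hd := contDiff_indicator hB hC.isClosed hCB hg hg0
  have hc : HasCompactSupport (C.indicator g) :=
    HasCompactSupport.intro hC fun x hx => Set.indicator_of_notMem hx g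
  have heq : ∀ x ∈ B, fderiv ℝ (C.indicator g) x v = fderiv ℝ g x v := fun x hx => by
    have : C.indicator g =ᶠ[𝓝 x] g := by
      filter_upwards [hB.mem_nhds hx] with z hz
      by_cases hzC : z ∈ C
      · simp [hzC]
      · simp [hzC, hg0 z ⟨hz, hzC⟩]
    rw [this.fderiv_eq]
  have h0 : ∀ x, x ∉ B → fderiv ℝ (C.indicator g) x v = 0 := fun x hx => by
    have : C.indicator g =ᶠ[𝓝 x] fun _ => 0 := by
      filter_upwards [hC.isClosed.isOpen_compl.mem_nhds fun h => hx (hCB h)] with z hz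
      exact Set.indicator_of_notMem hz g
    rw [this.fderiv_eq]; simp
  have hi' : Integrable (fun x => fderiv ℝ (C.indicator g) x v) μ :=
    ((hd.continuous_fderiv one_ne_zero).clm_apply
      continuous_const).integrable_of_hasCompactSupport (hc.fderiv_apply ℝ v)
  refine ⟨hi'.integrableOn.congr_fun heq hB.measurableSet, ?_⟩
  rw [← setIntegral_congr_fun hB.measurableSet heq, setIntegral_eq_integral_of_forall_compl_eq_zero h0]
  exact integral_fderiv_eq_zero_of_hasCompactSupport μ hd hc v

theorem ContDiffOn.continuousAlternatingMap_apply {E F G : Type*} [NormedAddCommGroup E]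
    [NormedSpace ℝ E] [NormedAddCommGroup F] [NormedSpace ℝ F] [NormedAddCommGroup G]
    [NormedSpace ℝ G] [CompleteSpace G] {m : ℕ} {n : WithTop ℕ∞} {B : Set E} {η : E → F [⋀^Fin m]→L[ℝ] G}
    {w : E → Fin m → F} (hη : ContDiffOn ℝ n η B) (hw : ContDiffOn ℝ n w B) :
    ContDiffOn ℝ n (fun y => η y (w y)) B := by
  intro y hy
  have h := (ContinuousLinearMap.analyticAt_uncurry_of_multilinear
    (ContinuousAlternatingMap.toContinuousMultilinearMapCLM (𝕜 := ℝ) (E := F) (F := G)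
      (ι := Fin m) ℝ) (x := (η y, w y))).contDiffAt (n := n)
  exact h.comp_contDiffWithinAt y ((hη y hy).prodMk (hw y hy))

/-- **Stokes' theorem** in a coordinate domain `B`, for the pull-back of a form whose support in
`B` is compact. -/
theorem setIntegral_extDeriv_pullback_eq_zero {k : ℕ} {E : Type*} [NormedAddCommGroup E]
    [NormedSpace ℝ E] {B C : Set (Fin (k + 1) → ℝ)} (hB : IsOpen B) (hC : IsCompact C)
    (hCB : C ⊆ B) {ψ : (Fin (k + 1) → ℝ) → E} (hψ : ContDiffOn ℝ ∞ ψ B)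
    {η : E → E [⋀^Fin k]→L[ℝ] ℂ} (hη : ContDiff ℝ ∞ η) (h0 : ∀ y ∈ B \ C, η (ψ y) = 0) :
    ∫ y in B, extDeriv η (ψ y) (fun i => fderiv ℝ ψ y (Pi.single i 1)) = 0 := by
  set α : (Fin (k + 1) → ℝ) → (Fin (k + 1) → ℝ) [⋀^Fin k]→L[ℝ] ℂ :=
    fun y => (η (ψ y)).compContinuousLinearMap (fderiv ℝ ψ y) with hα
  have hψ' : ContDiffOn ℝ ∞ (fderiv ℝ ψ) B := hψ.fderiv_of_isOpen hB (by simp)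
  have hαw : ∀ w, ContDiffOn ℝ 1 (fun y => α y w) B := fun w =>
    (ContDiffOn.continuousAlternatingMap_apply (hη.comp_contDiffOn hψ)
      (contDiffOn_pi.2 fun i => hψ'.clm_apply contDiffOn_const)).of_le (by simp)
  let e : Fin (k + 1) → Fin (k + 1) → ℝ := fun i => Pi.single i 1
  -- The exterior derivative commutes with pull-back, so the integrand is `dα` on the standard
  -- frame, an alternating sum of partial derivatives of coefficients of `α`.
  have key : ∀ y ∈ B, extDeriv η (ψ y) (fun i => fderiv ℝ ψ y (Pi.single i 1)) =
      ∑ i : Fin (k + 1), (-1 : ℤ) ^ i.val •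
        fderiv ℝ (fun z => α z (i.removeNth e)) y (e i) := by
    intro y hy
    have hy' := hB.mem_nhds hy
    have hdα : DifferentiableAt ℝ α y :=
      ((hη.differentiable (by simp) _).comp y
        ((hψ.contDiffAt hy').differentiableAt (by simp))).continuousAlternatingMapCompContinuousLinearMap
        ((hψ'.contDiffAt hy').differentiableAt (by simp))
    rw [← extDeriv_apply hdα, hα, extDeriv_pullback (hη.differentiable (by simp) _)
      (hψ.contDiffAt hy') (by
        rw [minSmoothness_of_isRCLikeNormedField]; exact WithTop.coe_le_coe.2 le_top)]
    rfl
  have hz : ∀ i : Fin (k + 1), _ := fun i => setIntegral_fderiv_eq_zero volume hB hC hCB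
    (hαw (i.removeNth e)) (fun y hy => by simp [hα, h0 y hy]) (e i)
  rw [setIntegral_congr_fun hB.measurableSet key]
  refine (integral_finsetSum _ fun i _ => (hz i).1.smul ((-1 : ℤ) ^ i.val)).trans
    (Finset.sum_eq_zero fun i _ => ?_)
  rcases neg_one_pow_eq_or ℤ i.val with h | h <;> simp [h, integral_neg, (hz i).2]

end LocalStokes

end PluriLagrangian
end

noncomputable section

namespace PluriLagrangian

/-! ### Change of coordinates between patches -/

/-- Top-degree alternating maps form a line spanned by the determinant. It suffices to compare on
injective choices of basis vectors, which are permutations of the basis, and there both sides are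
the sign times the value on the basis. -/
theorem alternatingMap_apply_eq_det_smul {n : ℕ} {G : Type*} [AddCommGroup G] [Module ℝ G]
    (h : (Fin n → ℝ) [⋀^Fin n]→ₗ[ℝ] G) (w : Fin n → Fin n → ℝ) :
    h w = (Matrix.of w).det • h fun i => Pi.single i 1 := by
  suffices hh : h = (LinearMap.toSpanSingleton ℝ G (h fun i => Pi.single i 1)).compAlternatingMap
      Matrix.detRowAlternating by
    conv_lhs => rw [hh]
    rfl
  refine (Pi.basisFun ℝ (Fin n)).ext_alternating fun v hv => ?_
  obtain ⟨σ, rfl⟩ : ∃ σ : Equiv.Perm (Fin n), v = σ :=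
    ⟨Equiv.ofBijective v (Finite.injective_iff_bijective.1 hv), rfl⟩
  have h1 := h.map_perm (fun i => (Pi.single i 1 : Fin n → ℝ)) σ
  have h2 := (Matrix.detRowAlternating (R := ℝ) (n := Fin n)).map_perm
    (fun i => (Pi.single i 1 : Fin n → ℝ)) σ
  have h3 : Matrix.detRowAlternating (R := ℝ) (n := Fin n)
      (fun i => (Pi.single i 1 : Fin n → ℝ)) = 1 := by
    have : (Matrix.of fun i => (Pi.single i 1 : Fin n → ℝ)) = 1 := by
      ext i j; simp [Matrix.one_apply, Pi.single_apply, eq_comm]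
    exact (congrArg Matrix.det this).trans Matrix.det_one
  rw [h3] at h2
  simp only [Pi.basisFun_apply, Function.comp_def] at *
  rw [h1]
  simp [h2]

theorem alternatingMap_comp_eq_det_smul {n : ℕ} {E G : Type*} [AddCommGroup E] [Module ℝ E]
    [AddCommGroup G] [Module ℝ G] (h : E [⋀^Fin n]→ₗ[ℝ] G) (A : (Fin n → ℝ) →ₗ[ℝ] E)
    (τ : (Fin n → ℝ) →ₗ[ℝ] (Fin n → ℝ)) :
    (h fun i => A (τ (Pi.single i 1))) = LinearMap.det τ • h fun i => A (Pi.single i 1) := by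
  have := alternatingMap_apply_eq_det_smul (h.compLinearMap A) fun i => τ (Pi.single i 1)
  have hdet : (Matrix.of fun i => τ (Pi.single i 1)).det = LinearMap.det τ := by
    rw [← LinearMap.det_toMatrix', ← Matrix.det_transpose]
    congr 1
  rw [hdet] at this
  exact this

namespace Patch

open MeasureTheory

variable {k N : ℕ} {M : Set (MultiTime N)}

theorem differentiableAt (φ : Patch k M) {y : Fin (k + 1) → ℝ} (hy : y ∈ φ.dom) :
    DifferentiableAt ℝ φ.map y :=
  (φ.contDiffOn.contDiffAt (φ.isOpen_dom.mem_nhds hy)).differentiableAt (by simp)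

theorem image_subset (φ : Patch k M) : φ.image ⊆ M := by
  obtain ⟨W, _, hW⟩ := φ.image_open
  exact hW.trans_subset Set.inter_subset_left

theorem map_mem (φ : Patch k M) {y : Fin (k + 1) → ℝ} (hy : y ∈ φ.dom ∩ halfSpace k) :
    φ.map y ∈ M :=
  φ.image_subset ⟨y, hy, rfl⟩

theorem injOn (φ : Patch k M) : Set.InjOn φ.map (φ.dom ∩ halfSpace k) :=
  Set.injOn_iff_injective.2 φ.embedding.injective

theorem continuousOn (φ : Patch k M) : ContinuousOn φ.map φ.dom := φ.contDiffOn.continuousOn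

theorem continuousOn_frame (φ : Patch k M) : ContinuousOn φ.frame φ.dom :=
  continuousOn_pi.2 fun _ =>
    ((φ.contDiffOn.fderiv_of_isOpen (m := ∞) φ.isOpen_dom (by simp)).continuousOn).clm_apply
      continuousOn_const

theorem isClosed_halfSpace (k : ℕ) : IsClosed (halfSpace k) :=
  isClosed_le continuous_const (continuous_apply 0)

theorem measurableSet_dom_inter (φ : Patch k M) : MeasurableSet (φ.dom ∩ halfSpace k) :=
  φ.isOpen_dom.measurableSet.inter (isClosed_halfSpace k).measurableSet

/-- The coordinate change `ψ⁻¹ ∘ φ`. -/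
def transition (φ ψ : Patch k M) (x : Fin (k + 1) → ℝ) : Fin (k + 1) → ℝ :=
  Function.invFunOn ψ.map (ψ.dom ∩ halfSpace k) (φ.map x)

theorem transition_mem (φ ψ : Patch k M) {x : Fin (k + 1) → ℝ} (hx : φ.map x ∈ ψ.image) :
    φ.transition ψ x ∈ ψ.dom ∩ halfSpace k :=
  Function.invFunOn_mem hx

theorem map_transition (φ ψ : Patch k M) {x : Fin (k + 1) → ℝ} (hx : φ.map x ∈ ψ.image) :
    ψ.map (φ.transition ψ x) = φ.map x :=
  Function.invFunOn_eq hx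

theorem continuousOn_transition (φ ψ : Patch k M) {s : Set (Fin (k + 1) → ℝ)} (hs : s ⊆ φ.dom)
    (h : ∀ x ∈ s, φ.map x ∈ ψ.image) : ContinuousOn (φ.transition ψ) s := by
  let τ : s → ↥(ψ.dom ∩ halfSpace k) := fun x => ⟨φ.transition ψ x, φ.transition_mem ψ (h x x.2)⟩
  have hτ : Continuous τ := by
    rw [ψ.embedding.isInducing.continuous_iff]
    refine (continuousOn_iff_continuous_domRestrict.1 (φ.continuousOn.mono hs)).congr fun x => ?_
    exact (φ.map_transition ψ (h x x.2)).symm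
  rw [continuousOn_iff_continuous_domRestrict]
  exact continuous_subtype_val.comp hτ

/-- The inverse function theorem is avoided: `ψ ∘ τ = φ` with `τ` continuous and `Dψ` having a
linear left inverse already makes `τ` differentiable. Mere differentiability is all that the change
of variables formula asks for. -/
theorem exists_hasFDerivAt_transition (φ ψ : Patch k M) {s : Set (Fin (k + 1) → ℝ)}
    (hso : IsOpen s) (hs : s ⊆ φ.dom) (h : ∀ x ∈ s, φ.map x ∈ ψ.image)
    {x : Fin (k + 1) → ℝ} (hx : x ∈ s) :
    ∃ τ' : (Fin (k + 1) → ℝ) →L[ℝ] (Fin (k + 1) → ℝ), HasFDerivAt (φ.transition ψ) τ' x ∧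
      fderiv ℝ φ.map x = (fderiv ℝ ψ.map (φ.transition ψ x)).comp τ' := by
  have hmem := φ.transition_mem ψ (h x hx)
  have hψ := (ψ.differentiableAt hmem.1).hasFDerivAt
  have hφ := (φ.differentiableAt (hs hx)).hasFDerivAt
  have hev : ψ.map ∘ φ.transition ψ =ᶠ[𝓝 x] φ.map := by
    filter_upwards [hso.mem_nhds hx] with z hz using φ.map_transition ψ (h z hz)
  obtain ⟨π, hπ⟩ := LinearMap.exists_leftInverse_of_injective
    (fderiv ℝ ψ.map (φ.transition ψ x) : (Fin (k + 1) → ℝ) →ₗ[ℝ] MultiTime N)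
    (LinearMap.ker_eq_bot.2 (ψ.immersion _ hmem))
  have hτ := HasFDerivAt.of_comp_of_leftInverse (f'symm := π.toContinuousLinearMap)
    ((φ.continuousOn_transition ψ hs h).continuousAt (hso.mem_nhds hx)) hψ hφ hev
    fun z => LinearMap.congr_fun hπ z
  exact ⟨_, hτ, hφ.unique ((hψ.comp x hτ).congr_of_eventuallyEq hev.symm)⟩

end Patch

namespace Surface

open MeasureTheory

variable {k N : ℕ}

/-- The pull-back density of the form `η` with the sign given by the orientation. -/
def density (Γ : Surface k N) (φ : Patch k Γ.carrier)
    (η : MultiTime N → HCovector N (k + 1)) (y : Fin (k + 1) → ℝ) : ℂ :=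
  (SignType.sign (Γ.orientation (φ.map y) (φ.frame y)) : ℝ) • η (φ.map y) (φ.frame y)

/-- The determinant enters twice, by its sign through the orientation and by its value through `η`;
the product is the absolute value of the Jacobian. -/
theorem density_transition (Γ : Surface k N) (φ ψ : Patch k Γ.carrier)
    (η : MultiTime N → HCovector N (k + 1)) {x : Fin (k + 1) → ℝ}
    {τ' : (Fin (k + 1) → ℝ) →L[ℝ] (Fin (k + 1) → ℝ)} (hx : φ.map x ∈ ψ.image)
    (hτ' : fderiv ℝ φ.map x = (fderiv ℝ ψ.map (φ.transition ψ x)).comp τ') :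
    Γ.density φ η x = |τ'.det| • Γ.density ψ η (φ.transition ψ x) := by
  have hdet : ∀ {G : Type} [NormedAddCommGroup G] [NormedSpace ℝ G]
      (h : (MultiTime N) [⋀^Fin (k + 1)]→L[ℝ] G),
      h (φ.frame x) = τ'.det • h (ψ.frame (φ.transition ψ x)) := fun h => by
    have := alternatingMap_comp_eq_det_smul h.toAlternatingMap
      (fderiv ℝ ψ.map (φ.transition ψ x) : (Fin (k + 1) → ℝ) →ₗ[ℝ] MultiTime N)
      (τ' : (Fin (k + 1) → ℝ) →ₗ[ℝ] (Fin (k + 1) → ℝ))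
    have hf : φ.frame x = fun i => fderiv ℝ ψ.map (φ.transition ψ x) (τ' (Pi.single i 1)) := by
      ext1 i
      rw [Patch.frame, hτ']; rfl
    rw [hf]
    exact this
  rw [density, density, φ.map_transition ψ hx, hdet, hdet, smul_eq_mul, sign_mul, smul_smul,
    smul_smul]
  congr 1
  rw [← sign_mul_self τ'.det]
  push_cast
  ring

/-- The part of the integral over `Γ` that is weighted by `w`, in the coordinates of a patch `φ`,
can be computed in a patch `ψ` that contains the support. -/
theorem setIntegral_density_eq (Γ : Surface k N) (φ ψ : Patch k Γ.carrier)
    (η : MultiTime N → HCovector N (k + 1)) (w : MultiTime N → ℝ) {B : Set (Fin (k + 1) → ℝ)}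
    (hB : IsOpen B) (hBψ : B ⊆ ψ.dom ∩ halfSpace k)
    (hη : ∀ p ∈ Γ.carrier, p ∉ ψ.map '' B → η p = 0) (hη' : ∀ p ∈ Γ.boundary, η p = 0)
    (hw : ∀ p ∈ Γ.carrier, p ∉ φ.image → w p = 0) :
    ∫ y in φ.dom ∩ halfSpace k, w (φ.map y) • Γ.density φ η y =
      ∫ y in B, w (ψ.map y) • Γ.density ψ η y := by
  obtain ⟨W, hW, hWim⟩ := ψ.image_open
  obtain ⟨W', hW', hpre⟩ := ψ.embedding.isInducing.isOpen_iff.1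
    (hB.preimage continuous_subtype_val)
  have hBW : ∀ y ∈ ψ.dom ∩ halfSpace k, ψ.map y ∈ W' ↔ y ∈ B := fun y hy =>
    Set.ext_iff.1 hpre ⟨y, hy⟩
  -- The part of the overlap with `y 0 > 0` in the coordinates of `φ`. Leaving out boundary
  -- parameters makes it open in the whole space and loses nothing, as `η` vanishes on the boundary.
  set s : Set (Fin (k + 1) → ℝ) := (φ.dom ∩ {y | 0 < y 0}) ∩ φ.map ⁻¹' (W ∩ W') with hs
  have hso : IsOpen s := (φ.continuousOn.mono Set.inter_subset_left).isOpen_inter_preimage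
    (φ.isOpen_dom.inter (isOpen_lt continuous_const (continuous_apply 0))) (hW.inter hW')
  have hsd : s ⊆ φ.dom := fun y hy => hy.1.1
  have hsH : s ⊆ φ.dom ∩ halfSpace k := fun y hy => ⟨hy.1.1, show 0 ≤ y 0 from le_of_lt hy.1.2⟩
  have hsψ : ∀ x ∈ s, φ.map x ∈ ψ.image := fun x hx =>
    hWim.ge ⟨φ.map_mem (hsH hx), hx.2.1⟩
  have hτB : ∀ x ∈ s, φ.transition ψ x ∈ B := fun x hx =>
    (hBW _ (φ.transition_mem ψ (hsψ x hx))).1 (by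
      rw [φ.map_transition ψ (hsψ x hx)]; exact hx.2.2)
  have hinj : Set.InjOn (φ.transition ψ) s := fun x hx y hy hxy =>
    φ.injOn (hsH hx) (hsH hy) (by
      rw [← φ.map_transition ψ (hsψ x hx), hxy, φ.map_transition ψ (hsψ y hy)])
  choose! τ' hτ' hτφ using fun x (hx : x ∈ s) =>
    φ.exists_hasFDerivAt_transition ψ hso hsd hsψ hx
  have hmems : ∀ y ∈ φ.dom ∩ halfSpace k, φ.map y ∈ ψ.map '' B → η (φ.map y) ≠ 0 → y ∈ s := by
    rintro y hy ⟨z, hz, hzy⟩ hne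
    refine ⟨⟨hy.1, lt_of_le_of_ne hy.2 fun h => hne (hη' _ ⟨φ, y, hy.1, h.symm, rfl⟩)⟩, ?_, ?_⟩
    · exact (hWim.le ⟨z, hBψ hz, hzy⟩).2
    · rw [← hzy]; exact (hBW z (hBψ hz)).2 hz
  -- Both integrals shrink to the overlap, to `s` on one side and to its image under the transition
  -- map on the other, and are then related by the change of variables formula.
  rw [setIntegral_eq_of_subset_of_forall_sdiff_eq_zero φ.measurableSet_dom_inter hsH,
    setIntegral_eq_of_subset_of_forall_sdiff_eq_zero (s := φ.transition ψ '' s) hB.measurableSet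
      (Set.image_subset_iff.2 hτB),
    integral_image_eq_integral_abs_det_fderiv_smul volume hso.measurableSet
      (fun x hx => (hτ' x hx).hasFDerivWithinAt) hinj]
  · refine setIntegral_congr_fun hso.measurableSet fun x hx => ?_
    rw [Γ.density_transition φ ψ η (hsψ x hx) (hτφ x hx), φ.map_transition ψ (hsψ x hx),
      smul_comm]
  · rintro y ⟨hyB, hy⟩
    by_cases hw0 : w (ψ.map y) = 0
    · simp [hw0]
    by_cases hη0 : η (ψ.map y) = 0
    · simp [density, hη0]
    refine absurd ?_ hy
    obtain ⟨x, hx, hxy⟩ : ψ.map y ∈ φ.image := by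
      by_contra h
      exact hw0 (hw _ (ψ.map_mem (hBψ hyB)) h)
    have hxs : x ∈ s := hmems x hx ⟨y, hyB, hxy.symm⟩ (by rwa [hxy])
    exact ⟨x, hxs, ψ.injOn (φ.transition_mem ψ (hsψ x hxs)) (hBψ hyB)
      ((φ.map_transition ψ (hsψ x hxs)).trans hxy)⟩
  · rintro y ⟨hy, hys⟩
    have : η (φ.map y) = 0 := by
      by_contra hne
      refine hys (hmems y hy ?_ hne)
      by_contra h
      exact hne (hη _ (φ.map_mem hy) h)
    simp [density, this]

end Surface

end PluriLagrangian
end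

noncomputable section

namespace PluriLagrangian

/-! ### Stokes' theorem on a surface -/

theorem continuousOn_continuousAlternatingMap_apply {E F G : Type*} [TopologicalSpace E]
    [NormedAddCommGroup F] [NormedSpace ℝ F] [NormedAddCommGroup G] [NormedSpace ℝ G]
    [CompleteSpace G] {m : ℕ} {B : Set E} {η : E → F [⋀^Fin m]→L[ℝ] G}
    {w : E → Fin m → F} (hη : ContinuousOn η B) (hw : ContinuousOn w B) :
    ContinuousOn (fun y => η y (w y)) B := by
  intro y hy
  have h := (ContinuousLinearMap.analyticAt_uncurry_of_multilinear
    (ContinuousAlternatingMap.toContinuousMultilinearMapCLM (𝕜 := ℝ) (E := F) (F := G)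
      (ι := Fin m) ℝ) (x := (η y, w y))).continuousAt
  exact h.tendsto.comp ((hη y hy).prodMk (hw y hy))

namespace Patch

variable {k N : ℕ} {M : Set (MultiTime N)}

theorem isCompact_preimage (φ : Patch k M) {K : Set (MultiTime N)} (hK : IsCompact K)
    (hKφ : K ⊆ φ.image) : IsCompact (φ.dom ∩ halfSpace k ∩ φ.map ⁻¹' K) := by
  have hr : K ⊆ Set.range ((φ.dom ∩ halfSpace k).domRestrict φ.map) := fun p hp => by
    obtain ⟨y, hy, hyp⟩ := hKφ hp
    exact ⟨⟨y, hy⟩, hyp⟩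
  have h := ((φ.embedding.isInducing.isCompact_preimage_iff hr).2 hK).image continuous_subtype_val
  convert h using 1
  ext y
  constructor
  · rintro ⟨hy, hyK⟩
    exact ⟨⟨y, hy⟩, hyK, rfl⟩
  · rintro ⟨z, hz, rfl⟩
    exact ⟨z.2, hz⟩

end Patch

namespace Surface

open MeasureTheory
open scoped Manifold

variable {k N : ℕ}

/-! ### Orientation sign, densities and the integral over a surface -/

theorem continuousOn_orientation_frame (Γ : Surface k N) (φ : Patch k Γ.carrier) :
    ContinuousOn (fun y => Γ.orientation (φ.map y) (φ.frame y)) (φ.dom ∩ halfSpace k) :=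
  continuousOn_continuousAlternatingMap_apply
    (Γ.continuousOn_orientation.comp (φ.continuousOn.mono Set.inter_subset_left)
      fun _ hy => φ.map_mem hy) (φ.continuousOn_frame.mono Set.inter_subset_left)

/-- The orientation form never vanishes on a coordinate frame, so its sign is locally constant. -/
theorem continuousOn_sign (Γ : Surface k N) (φ : Patch k Γ.carrier) :
    ContinuousOn (fun y => SignType.sign (Γ.orientation (φ.map y) (φ.frame y)))
      (φ.dom ∩ halfSpace k) := fun y hy =>
  (continuousAt_sign_of_ne_zero (Γ.orientation_ne_zero φ y hy)).tendsto.comp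
    (Γ.continuousOn_orientation_frame φ y hy)

theorem continuousOn_density (Γ : Surface k N) (φ : Patch k Γ.carrier)
    {η : MultiTime N → HCovector N (k + 1)} (hη : ContinuousOn η Γ.carrier) :
    ContinuousOn (Γ.density φ η) (φ.dom ∩ halfSpace k) := by
  have h : ContinuousOn
      (fun y => ((SignType.sign (Γ.orientation (φ.map y) (φ.frame y)) : SignType) : ℝ))
      (φ.dom ∩ halfSpace k) :=
    (continuous_of_discreteTopology (f := fun s : SignType => (s : ℝ))).comp_continuousOn
      (Γ.continuousOn_sign φ)
  exact h.smul (continuousOn_continuousAlternatingMap_apply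
    (hη.comp (φ.continuousOn.mono Set.inter_subset_left) fun _ hy => φ.map_mem hy)
      (φ.continuousOn_frame.mono Set.inter_subset_left))

/-- The partition of unity used in the definition of the integral. -/
def partition (Γ : Surface k N) : Γ.Partition := Classical.choice Γ.nonempty_partition

theorem integral_eq_finsum (Γ : Surface k N) (η : MultiTime N → HCovector N (k + 1)) :
    Γ.integral η = ∑ᶠ i, ∫ y in (Γ.partition.patch i).dom ∩ halfSpace k,
      Γ.partition.weight i ((Γ.partition.patch i).map y) •
        Γ.density (Γ.partition.patch i) η y := by
  refine finsum_congr fun i => integral_congr_ae (Filter.Eventually.of_forall fun y => ?_)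
  simp only [density, smul_smul]
  rw [mul_comm]
  rfl

namespace Partition

variable {Γ : Surface k N} (P : Γ.Partition)

theorem weight_eq_zero_of_notMem_image (i : P.ι) {p : MultiTime N} (hp : p ∈ Γ.carrier)
    (h : p ∉ (P.patch i).image) : P.weight i p = 0 := by
  obtain ⟨K, _, hK, hK0⟩ := P.compact_support i
  exact hK0 p hp fun hpK => h (hK hpK)

theorem exists_finset_weight_eq_zero {K : Set (MultiTime N)} (hK : IsCompact K)
    (hKΓ : K ⊆ Γ.carrier) : ∃ T : Finset P.ι, ∀ i ∉ T, ∀ p ∈ K, P.weight i p = 0 := by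
  have hfin : {i | ∃ q ∈ Γ.carrier ∩ K, P.weight i q ≠ 0}.Finite := by
    refine hK.induction_on (p := fun s => {i | ∃ q ∈ Γ.carrier ∩ s, P.weight i q ≠ 0}.Finite)
      ?_ ?_ ?_ ?_
    · simp
    · intro s t hst ht
      exact ht.subset fun i ⟨q, hq, h⟩ => ⟨q, ⟨hq.1, hst hq.2⟩, h⟩
    · intro s t hs ht
      refine (hs.union ht).subset ?_
      rintro i ⟨q, ⟨hq, hq' | hq'⟩, h⟩
      · exact Or.inl ⟨q, ⟨hq, hq'⟩, h⟩
      · exact Or.inr ⟨q, ⟨hq, hq'⟩, h⟩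
    · intro p hp
      obtain ⟨W, hW, hfin⟩ := P.locallyFinite p (hKΓ hp)
      exact ⟨W, mem_nhdsWithin_of_mem_nhds hW, hfin⟩
  refine ⟨hfin.toFinset, fun i hi p hp => ?_⟩
  by_contra h
  exact hi (hfin.mem_toFinset.2 ⟨p, ⟨hKΓ hp, hp⟩, h⟩)

theorem sum_weight_eq_one {K : Set (MultiTime N)} (hKΓ : K ⊆ Γ.carrier) {T : Finset P.ι}
    (hT : ∀ i ∉ T, ∀ p ∈ K, P.weight i p = 0) {p : MultiTime N} (hp : p ∈ K) :
    ∑ i ∈ T, P.weight i p = 1 := by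
  rw [← P.sum_eq_one p (hKΓ hp), finsum_eq_sum_of_support_subset]
  intro i hi
  by_contra h
  exact hi (hT i h p hp)

theorem integrableOn_weight_density (i : P.ι) {η : MultiTime N → HCovector N (k + 1)}
    (hη : ContinuousOn η Γ.carrier) :
    IntegrableOn (fun y => P.weight i ((P.patch i).map y) • Γ.density (P.patch i) η y)
      ((P.patch i).dom ∩ halfSpace k) := by
  obtain ⟨K, hK, hKi, hK0⟩ := P.compact_support i
  have hC := (P.patch i).isCompact_preimage hK hKi
  have hsub : (P.patch i).dom ∩ halfSpace k ∩ (P.patch i).map ⁻¹' K ⊆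
    (P.patch i).dom ∩ halfSpace k := Set.inter_subset_left
  have hcont : ContinuousOn
      (fun y => P.weight i ((P.patch i).map y) • Γ.density (P.patch i) η y)
      ((P.patch i).dom ∩ halfSpace k) :=
    ((P.continuousOn i).comp ((P.patch i).continuousOn.mono Set.inter_subset_left)
      fun _ hy => (P.patch i).map_mem hy).smul (Γ.continuousOn_density (P.patch i) hη)
  refine ((hcont.mono hsub).integrableOn_compact hC).of_forall_sdiff_eq_zero
    (P.patch i).measurableSet_dom_inter ?_
  rintro y ⟨hy, hyK⟩
  rw [hK0 _ ((P.patch i).map_mem hy) fun h => hyK ⟨hy, h⟩, zero_smul]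

end Partition

/-- The set `T` depends only on `K`, so all forms vanishing on `Γ` outside `K` are integrated by
sums over the same finite set of patches. This makes additivity and differentiation of the integral
accessible. -/
theorem integral_eq_sum (Γ : Surface k N) {η : MultiTime N → HCovector N (k + 1)}
    {K : Set (MultiTime N)} (h0 : ∀ p ∈ Γ.carrier, p ∉ K → η p = 0)
    {T : Finset Γ.partition.ι} (hT : ∀ i ∉ T, ∀ p ∈ K, Γ.partition.weight i p = 0) :
    Γ.integral η = ∑ i ∈ T, ∫ y in (Γ.partition.patch i).dom ∩ halfSpace k,
      Γ.partition.weight i ((Γ.partition.patch i).map y) •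
        Γ.density (Γ.partition.patch i) η y := by
  rw [integral_eq_finsum, finsum_eq_sum_of_support_subset]
  intro i hi
  by_contra hiT
  refine hi ?_
  refine setIntegral_eq_zero_of_forall_eq_zero fun y hy => ?_
  by_cases hK : (Γ.partition.patch i).map y ∈ K
  · rw [hT i hiT _ hK, zero_smul]
  · simp [density, h0 _ ((Γ.partition.patch i).map_mem hy) hK]

theorem integral_congr (Γ : Surface k N) {η η' : MultiTime N → HCovector N (k + 1)}
    (h : ∀ p ∈ Γ.carrier, η p = η' p) : Γ.integral η = Γ.integral η' := by
  rw [integral_eq_finsum, integral_eq_finsum]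
  refine finsum_congr fun i =>
    setIntegral_congr_fun (Γ.partition.patch i).measurableSet_dom_inter fun y hy => ?_
  simp [density, h _ ((Γ.partition.patch i).map_mem hy)]

/-- No integrability or support condition is needed: the default value `0` of the integral and of
the sum is compatible with negation. -/
theorem integral_neg (Γ : Surface k N) (η : MultiTime N → HCovector N (k + 1)) :
    Γ.integral (fun p => -η p) = -Γ.integral η := by
  rw [integral_eq_finsum, integral_eq_finsum, ← finsum_neg_distrib]
  refine finsum_congr fun i => ?_
  rw [← MeasureTheory.integral_neg]
  simp [density]

theorem integral_finsetSum (Γ : Surface k N) {ι : Type*} (A : Finset ι)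
    {η : ι → MultiTime N → HCovector N (k + 1)} (hη : ∀ l ∈ A, ContinuousOn (η l) Γ.carrier)
    {K : Set (MultiTime N)} (hK : IsCompact K) (hKΓ : K ⊆ Γ.carrier)
    (h0 : ∀ l ∈ A, ∀ p ∈ Γ.carrier, p ∉ K → η l p = 0) :
    Γ.integral (fun p => ∑ l ∈ A, η l p) = ∑ l ∈ A, Γ.integral (η l) := by
  obtain ⟨T, hT⟩ := Γ.partition.exists_finset_weight_eq_zero hK hKΓ
  rw [Γ.integral_eq_sum (fun p hp hpK => Finset.sum_eq_zero fun l hl => h0 l hl p hp hpK) hT,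
    Finset.sum_congr rfl fun l hl => Γ.integral_eq_sum (h0 l hl) hT, Finset.sum_comm]
  refine Finset.sum_congr rfl fun i _ => ?_
  rw [← MeasureTheory.integral_finsetSum _ fun l hl =>
    Γ.partition.integrableOn_weight_density i (hη l hl)]
  simp only [density, ContinuousAlternatingMap.sum_apply, Finset.smul_sum]

/-- The integral of a form supported in a single patch. -/
theorem integral_eq_setIntegral_density (Γ : Surface k N) (ψ : Patch k Γ.carrier)
    {η : MultiTime N → HCovector N (k + 1)} (hη : ContinuousOn η Γ.carrier)
    {B C : Set (Fin (k + 1) → ℝ)} (hB : IsOpen B) (hBψ : B ⊆ ψ.dom ∩ halfSpace k)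
    (hC : IsCompact C) (hCB : C ⊆ B) (h0 : ∀ p ∈ Γ.carrier, p ∉ ψ.map '' C → η p = 0)
    (h0' : ∀ p ∈ Γ.boundary, η p = 0) :
    Γ.integral η = ∫ y in B, Γ.density ψ η y := by
  have hK : IsCompact (ψ.map '' C) := hC.image_of_continuousOn
    (ψ.continuousOn.mono fun y hy => (hBψ (hCB hy)).1)
  have hKΓ : ψ.map '' C ⊆ Γ.carrier := Set.image_subset_iff.2 fun y hy => ψ.map_mem (hBψ (hCB hy))
  obtain ⟨T, hT⟩ := Γ.partition.exists_finset_weight_eq_zero hK hKΓ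
  have hdens : ∀ y ∈ B \ C, Γ.density ψ η y = 0 := fun y hy => by
    have : η (ψ.map y) = 0 := h0 _ (ψ.map_mem (hBψ hy.1)) (by
      rintro ⟨z, hz, hzy⟩
      exact hy.2 (ψ.injOn (hBψ (hCB hz)) (hBψ hy.1) hzy ▸ hz))
    simp [density, this]
  -- Each weighted piece is moved to the patch `ψ`; there the weights add up to `1` on the support.
  rw [Γ.integral_eq_sum h0 hT, Finset.sum_congr rfl fun i _ =>
    Γ.setIntegral_density_eq (Γ.partition.patch i) ψ η (Γ.partition.weight i) hB hBψ
      (fun p hp hpB => h0 p hp fun h => hpB (Set.image_mono hCB h)) h0'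
      fun p hp => Γ.partition.weight_eq_zero_of_notMem_image i hp,
    ← MeasureTheory.integral_finsetSum]
  · refine setIntegral_congr_fun hB.measurableSet fun y hy => ?_
    simp only [← Finset.sum_smul]
    by_cases hyC : y ∈ C
    · rw [Γ.partition.sum_weight_eq_one hKΓ hT ⟨y, hyC, rfl⟩, one_smul]
    · rw [hdens y ⟨hy, hyC⟩, smul_zero]
  · intro i _
    have hcont : ContinuousOn (fun y => Γ.partition.weight i (ψ.map y) • Γ.density ψ η y) C :=
      (((Γ.partition.continuousOn i).comp (ψ.continuousOn.mono Set.inter_subset_left)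
        fun _ hy => ψ.map_mem hy).smul (Γ.continuousOn_density ψ hη)).mono (hCB.trans hBψ)
    refine (hcont.integrableOn_compact hC).of_forall_sdiff_eq_zero hB.measurableSet fun y hy => ?_
    rw [hdens y hy, smul_zero]

/-! ### Localization of exterior derivatives and Stokes' theorem -/

theorem continuous_extDeriv {E : Type*} [NormedAddCommGroup E] [NormedSpace ℝ E] {m : ℕ}
    {η : E → E [⋀^Fin m]→L[ℝ] ℂ} (hη : ContDiff ℝ ∞ η) : Continuous (extDeriv η) :=
  (ContinuousAlternatingMap.alternatizeUncurryFinCLM ℝ E ℂ).continuous.comp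
    (hη.continuous_fderiv (by simp))

theorem extDeriv_eq_zero_of_notMem_tsupport {E : Type*} [NormedAddCommGroup E] [NormedSpace ℝ E]
    {m : ℕ} {η : E → E [⋀^Fin m]→L[ℝ] ℂ} {p : E} (hp : p ∉ tsupport η) : extDeriv η p = 0 := by
  rw [(notMem_tsupport_iff_eventuallyEq.1 hp).extDeriv_eq]
  simp [extDeriv, ← ContinuousAlternatingMap.alternatizeUncurryFinCLM_apply]

theorem extDeriv_fun_finsetSum {E ι : Type*} [NormedAddCommGroup E] [NormedSpace ℝ E] {m : ℕ}
    (A : Finset ι) {η : ι → E → E [⋀^Fin m]→L[ℝ] ℂ} {p : E}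
    (hη : ∀ l ∈ A, DifferentiableAt ℝ (η l) p) :
    extDeriv (fun q => ∑ l ∈ A, η l q) p = ∑ l ∈ A, extDeriv (η l) p := by
  simp only [extDeriv, ← ContinuousAlternatingMap.alternatizeUncurryFinCLM_apply]
  rw [fderiv_fun_sum hη, map_sum]

/-- **Stokes' theorem** near an interior point of a surface. -/
theorem exists_isOpen_integral_extDeriv_eq_zero (Γ : Surface k N) {p : MultiTime N}
    (hp : p ∈ Γ.carrier) (hpb : p ∉ Γ.boundary) :
    ∃ U : Set (MultiTime N), IsOpen U ∧ p ∈ U ∧ ∀ η : MultiTime N → HCovector N k,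
      ContDiff ℝ ∞ η → tsupport η ⊆ U → Disjoint Γ.boundary (tsupport η) →
        Γ.integral (extDeriv η) = 0 := by
  obtain ⟨ψ, y₀, hy₀, rfl⟩ := Γ.exists_patch p hp
  have hy₀0 : 0 < y₀ 0 := lt_of_le_of_ne hy₀.2 fun h => hpb ⟨ψ, y₀, hy₀.1, h.symm, rfl⟩
  have hint : ψ.dom ∩ {y | 0 < y 0} ∈ 𝓝 y₀ :=
    (ψ.isOpen_dom.inter (isOpen_lt continuous_const (continuous_apply 0))).mem_nhds ⟨hy₀.1, hy₀0⟩
  have hsub : ψ.dom ∩ {y | 0 < y 0} ⊆ ψ.dom ∩ halfSpace k := fun y hy =>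
    ⟨hy.1, show 0 ≤ y 0 from le_of_lt hy.2⟩
  set σ := SignType.sign (Γ.orientation (ψ.map y₀) (ψ.frame y₀)) with hσ
  have hsign : ∀ᶠ y in 𝓝 y₀, SignType.sign (Γ.orientation (ψ.map y) (ψ.frame y)) = σ :=
    ((Γ.continuousOn_sign ψ).continuousAt (Filter.mem_of_superset hint hsub)).eventually
      (eventually_nhds_iff.2 ⟨{σ}, fun _ h => h, isOpen_discrete _, rfl⟩)
  -- On this ball the parameters are interior and the orientation sign is constant, so the sign can
  -- be taken out of the integral. The closed ball of radius `r / 2` serves as the compact set that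
  -- carries the supports.
  obtain ⟨r, hr, hball⟩ := Metric.mem_nhds_iff.1 (Filter.inter_mem hint hsign)
  have hBψ : Metric.ball y₀ r ⊆ ψ.dom ∩ halfSpace k := fun y hy => hsub (hball hy).1
  have hCB : Metric.closedBall y₀ (r / 2) ⊆ Metric.ball y₀ r :=
    Metric.closedBall_subset_ball (by linarith)
  obtain ⟨W, hW, hWim⟩ := ψ.image_open
  obtain ⟨W', hW', hpre⟩ := ψ.embedding.isInducing.isOpen_iff.1
    ((Metric.isOpen_ball (x := y₀) (ε := r / 2)).preimage continuous_subtype_val)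
  have hW'iff : ∀ y ∈ ψ.dom ∩ halfSpace k, ψ.map y ∈ W' ↔ y ∈ Metric.ball y₀ (r / 2) :=
    fun y hy => Set.ext_iff.1 hpre ⟨y, hy⟩
  refine ⟨W ∩ W', hW.inter hW', ⟨(hWim.le ⟨y₀, hy₀, rfl⟩).2,
    (hW'iff y₀ hy₀).2 (Metric.mem_ball_self (by linarith))⟩, fun η hη hηU hηb => ?_⟩
  rw [Γ.integral_eq_setIntegral_density ψ (continuous_extDeriv hη).continuousOn Metric.isOpen_ball
    hBψ (isCompact_closedBall y₀ (r / 2)) hCB]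
  · have hst := setIntegral_extDeriv_pullback_eq_zero Metric.isOpen_ball
      (isCompact_closedBall y₀ (r / 2)) hCB
      (ψ.contDiffOn.mono fun y hy => (hBψ hy).1) hη fun y hy => by
        by_contra hne
        exact hy.2 (Metric.ball_subset_closedBall
          ((hW'iff y (hBψ hy.1)).1 (hηU (subset_tsupport _ hne)).2))
    rw [setIntegral_congr_fun (g := fun y => (σ : ℝ) • extDeriv η (ψ.map y)
      fun i => fderiv ℝ ψ.map y (Pi.single i 1)) Metric.isOpen_ball.measurableSet,
      integral_smul, hst, smul_zero]
    intro y hy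
    simp only [density]
    rw [(hball hy).2]
    rfl
  · intro q hq hqC
    refine extDeriv_eq_zero_of_notMem_tsupport fun hqη => hqC ?_
    obtain ⟨y, hy, rfl⟩ := hWim.ge ⟨hq, (hηU hqη).1⟩
    exact ⟨y, Metric.ball_subset_closedBall ((hW'iff y hy).1 (hηU hqη).2), rfl⟩
  · exact fun q hq => extDeriv_eq_zero_of_notMem_tsupport fun hqη =>
      Set.disjoint_left.1 hηb hq hqη

/-- The partition is made on a compact neighbourhood `K'` of `K`, so the sum equals `1` on a
neighbourhood of each point of `K`. Equality on `K` alone would not suffice for taking exterior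
derivatives. -/
theorem exists_contDiff_partition {E : Type*} [NormedAddCommGroup E] [NormedSpace ℝ E]
    [FiniteDimensional ℝ E] {K : Set E} (hK : IsCompact K) (A : Finset E) (U : E → Set E)
    (hU : ∀ p ∈ A, IsOpen (U p)) (hKA : K ⊆ ⋃ p ∈ A, U p) :
    ∃ χ : A → E → ℝ, (∀ p, ContDiff ℝ ∞ (χ p)) ∧ (∀ p, tsupport (χ p) ⊆ U p) ∧
      ∀ q ∈ K, ∀ᶠ z in 𝓝 q, ∑ p, χ p z = 1 := by
  have hAo : IsOpen (⋃ p ∈ A, U p) := isOpen_biUnion hU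
  obtain ⟨K', hK', hKK', hK'A⟩ := exists_compact_between hK hAo hKA
  obtain ⟨χ, hχ⟩ := SmoothPartitionOfUnity.exists_isSubordinate 𝓘(ℝ, E)
    hK'.isClosed (fun p : A => U p) (fun p => hU p p.2) (fun q hq => by
      obtain ⟨p, hpA, hq⟩ := Set.mem_iUnion₂.1 (hK'A hq)
      exact Set.mem_iUnion.2 ⟨⟨p, hpA⟩, hq⟩)
  refine ⟨fun p => χ p, fun p => (χ p).contMDiff.contDiff, hχ, fun q hq => ?_⟩
  filter_upwards [isOpen_interior.mem_nhds (hKK' hq)] with z hz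
  rw [← finsum_eq_sum_of_fintype]
  exact χ.sum_eq_one (interior_subset hz)

/-- **Stokes' theorem** for forms that vanish near the boundary of the surface. -/
theorem integral_extDeriv_eq_zero (Γ : Surface k N) {η : MultiTime N → HCovector N k}
    (hη : ContDiff ℝ ∞ η) (hK : IsCompact (Γ.carrier ∩ tsupport η))
    (hb : Disjoint Γ.boundary (tsupport η)) : Γ.integral (extDeriv η) = 0 := by
  set K := Γ.carrier ∩ tsupport η with hKdef
  choose! U hUo hpU hU using fun p (hp : p ∈ K) =>
    Γ.exists_isOpen_integral_extDeriv_eq_zero hp.1 fun h => Set.disjoint_left.1 hb h hp.2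
  obtain ⟨A, hAK, hKA⟩ := hK.elim_nhds_subcover U fun p hp => (hUo p hp).mem_nhds (hpU p hp)
  obtain ⟨χ, hχd, hχ, hχ1⟩ := exists_contDiff_partition hK A U (fun p hp => hUo p (hAK p hp)) hKA
  have hχη : ∀ p : A, ContDiff ℝ ∞ fun q => χ p q • η q := fun p =>
    (hχd p).smul hη
  have hsupp : ∀ p : A, tsupport (fun q => χ p q • η q) ⊆ tsupport η := fun p =>
    tsupport_smul_subset_right (χ p) η
  -- The terms in `dχ_p` cancel because the `χ_p` sum to `1` near every point of `K`; outside the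
  -- support of `η` both sides vanish.
  have hsum : ∀ q ∈ Γ.carrier,
      extDeriv η q = ∑ p : A, extDeriv (fun q => χ p q • η q) q := fun q hq => by
    by_cases hqη : q ∈ tsupport η
    · rw [← extDeriv_fun_finsetSum _ fun p _ => (hχη p).differentiable (by simp) q]
      refine Filter.EventuallyEq.extDeriv_eq ?_
      filter_upwards [hχ1 q ⟨hq, hqη⟩] with z hz
      rw [← Finset.sum_smul, hz, one_smul]
    · rw [extDeriv_eq_zero_of_notMem_tsupport hqη]
      exact (Finset.sum_eq_zero fun p _ =>
        extDeriv_eq_zero_of_notMem_tsupport fun h => hqη (hsupp p h)).symm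
  rw [Γ.integral_congr hsum, Γ.integral_finsetSum Finset.univ
    (fun p _ => (continuous_extDeriv (hχη p)).continuousOn) hK Set.inter_subset_left
    fun p _ q hq hqK => extDeriv_eq_zero_of_notMem_tsupport fun h => hqK ⟨hq, hsupp p h⟩]
  refine Finset.sum_eq_zero fun p _ => hU p (hAK p p.2) _ (hχη p) ?_ (hb.mono_right (hsupp p))
  exact (tsupport_smul_subset_left (χ p) η).trans (hχ p)

end Surface

end PluriLagrangian
end

noncomputable section

namespace PluriLagrangian

/-! ### Differentiation under the integral over a surface -/

namespace Surface

open MeasureTheory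

variable {k N : ℕ}

theorem density_apply_hasDerivAt (Γ : Surface k N) (φ : Patch k Γ.carrier)
    {G : ℝ → MultiTime N → HCovector N (k + 1)} {G' : MultiTime N → HCovector N (k + 1)} {ε : ℝ}
    {y : Fin (k + 1) → ℝ} (h : HasDerivAt (fun ε => G ε (φ.map y)) (G' (φ.map y)) ε) :
    HasDerivAt (fun ε => Γ.density φ (G ε) y) (Γ.density φ G' y) ε :=
  ((ContinuousAlternatingMap.apply ℝ (MultiTime N) ℂ (φ.frame y)).hasFDerivAt.comp_hasDerivAt
    ε h).const_smul (SignType.sign (Γ.orientation (φ.map y) (φ.frame y)) : ℝ)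

theorem continuousOn_density_uncurry (Γ : Surface k N) (φ : Patch k Γ.carrier)
    {G : ℝ × MultiTime N → HCovector N (k + 1)} {s : Set ℝ} {C : Set (Fin (k + 1) → ℝ)}
    (hC : C ⊆ φ.dom ∩ halfSpace k) (hG : ContinuousOn G (s ×ˢ (φ.map '' C))) :
    ContinuousOn (fun q : ℝ × (Fin (k + 1) → ℝ) => Γ.density φ (fun t => G (q.1, t)) q.2)
      (s ×ˢ C) := by
  have hsnd : Set.MapsTo Prod.snd (s ×ˢ C) (φ.dom ∩ halfSpace k) := fun q hq => hC hq.2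
  have h : ContinuousOn
      (fun y => ((SignType.sign (Γ.orientation (φ.map y) (φ.frame y)) : SignType) : ℝ))
      (φ.dom ∩ halfSpace k) :=
    (continuous_of_discreteTopology (f := fun s : SignType => (s : ℝ))).comp_continuousOn
      (Γ.continuousOn_sign φ)
  have hmap : ContinuousOn (fun q : ℝ × (Fin (k + 1) → ℝ) => φ.map q.2) (s ×ˢ C) :=
    (φ.continuousOn.mono Set.inter_subset_left).comp continuousOn_snd hsnd
  refine (h.comp continuousOn_snd hsnd).smul (continuousOn_continuousAlternatingMap_apply
    (hG.comp (continuousOn_fst.prodMk hmap) fun q hq => ⟨hq.1, q.2, hq.2, rfl⟩)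
    ((φ.continuousOn_frame.mono Set.inter_subset_left).comp continuousOn_snd hsnd))

/-- The weight confines the integral to a compact set of parameters, on which the derivative of the
integrand is bounded uniformly in small `ε`; dominated convergence applies with a constant bound. -/
theorem hasDerivAt_setIntegral_weight_density (Γ : Surface k N) (P : Γ.Partition) (i : P.ι)
    {G G' : ℝ → MultiTime N → HCovector N (k + 1)} {Ω : Set (ℝ × MultiTime N)} (hΩ : IsOpen Ω)
    (h0Ω : ∀ t ∈ Γ.carrier, ((0 : ℝ), t) ∈ Ω)
    (hG : ContinuousOn (fun q : ℝ × MultiTime N => G q.1 q.2) Ω)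
    (hG' : ContinuousOn (fun q : ℝ × MultiTime N => G' q.1 q.2) Ω)
    (hder : ∀ q ∈ Ω, HasDerivAt (fun ε => G ε q.2) (G' q.1 q.2) q.1) :
    HasDerivAt (fun ε => ∫ y in (P.patch i).dom ∩ halfSpace k,
        P.weight i ((P.patch i).map y) • Γ.density (P.patch i) (G ε) y)
      (∫ y in (P.patch i).dom ∩ halfSpace k,
        P.weight i ((P.patch i).map y) • Γ.density (P.patch i) (G' 0) y) 0 := by
  obtain ⟨K, hK, hKi, hK0⟩ := P.compact_support i
  set φ := P.patch i
  set C := φ.dom ∩ halfSpace k ∩ φ.map ⁻¹' K with hCdef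
  have hC : IsCompact C := φ.isCompact_preimage hK hKi
  have hCsub : C ⊆ φ.dom ∩ halfSpace k := Set.inter_subset_left
  have hφC : φ.map '' C ⊆ K := by rintro _ ⟨y, hy, rfl⟩; exact hy.2
  have hred : ∀ η : MultiTime N → HCovector N (k + 1),
      ∫ y in φ.dom ∩ halfSpace k, P.weight i (φ.map y) • Γ.density φ η y =
        ∫ y in C, P.weight i (φ.map y) • Γ.density φ η y := fun η => by
    refine setIntegral_eq_of_subset_of_forall_sdiff_eq_zero φ.measurableSet_dom_inter hCsub ?_
    rintro y ⟨hy, hyC⟩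
    rw [hK0 _ (φ.map_mem hy) fun h => hyC ⟨hy, h⟩, zero_smul]
  simp only [hred]
  -- The tube lemma provides one interval of `ε` around `0` that works for all points of the compact
  -- set `K` at once.
  obtain ⟨V, V', hV, _, h0V, hKV', hVV'⟩ := generalized_tube_lemma (s := {(0 : ℝ)})
    isCompact_singleton hK hΩ (by
      rintro ⟨ε, t⟩ ⟨hε, ht⟩
      obtain rfl : ε = 0 := hε
      exact h0Ω t (φ.image_subset (hKi ht)))
  obtain ⟨r, hr, hrV⟩ := Metric.nhds_basis_closedBall.mem_iff.1 (hV.mem_nhds (h0V rfl))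
  have hrK : Metric.closedBall (0 : ℝ) r ×ˢ (φ.map '' C) ⊆ Ω := fun q hq =>
    hVV' ⟨hrV hq.1, hKV' (hφC hq.2)⟩
  have hw : ContinuousOn (fun q : ℝ × (Fin (k + 1) → ℝ) => P.weight i (φ.map q.2))
      (Metric.closedBall (0 : ℝ) r ×ˢ C) :=
    ((P.continuousOn i).comp (φ.continuousOn.mono Set.inter_subset_left)
      fun _ hy => φ.map_mem hy).comp continuousOn_snd fun q hq => hCsub hq.2
  have hF := hw.smul (Γ.continuousOn_density_uncurry φ hCsub (hG.mono hrK))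
  have hF' := hw.smul (Γ.continuousOn_density_uncurry φ hCsub (hG'.mono hrK))
  have hslice : ∀ {F : ℝ × (Fin (k + 1) → ℝ) → ℂ},
      ContinuousOn F (Metric.closedBall (0 : ℝ) r ×ˢ C) → ∀ ε ∈ Metric.closedBall (0 : ℝ) r,
        IntegrableOn (fun y => F (ε, y)) C := fun hF ε hε =>
    (hF.comp (continuousOn_const.prodMk continuousOn_id) fun y hy => ⟨hε, hy⟩).integrableOn_compact
      hC
  obtain ⟨b, hb⟩ := ((isCompact_closedBall (0 : ℝ) r).prod hC).exists_bound_of_continuousOn hF'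
  have h0r : (0 : ℝ) ∈ Metric.closedBall (0 : ℝ) r := Metric.mem_closedBall_self hr.le
  have hmem : Metric.closedBall (0 : ℝ) r ∈ 𝓝 (0 : ℝ) := Metric.closedBall_mem_nhds 0 hr
  refine (hasDerivAt_integral_of_dominated_loc_of_deriv_le (bound := fun _ => b)
    (F := fun ε y => P.weight i (φ.map y) • Γ.density φ (G ε) y)
    (F' := fun ε y => P.weight i (φ.map y) • Γ.density φ (G' ε) y) hmem
    ?_ (hslice hF 0 h0r) (hslice hF' 0 h0r).aestronglyMeasurable ?_ ?_ ?_).2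
  · filter_upwards [hmem] with ε hε using (hslice hF ε hε).aestronglyMeasurable
  · exact (ae_restrict_mem hC.measurableSet).mono fun y hy ε hε => hb (ε, y) ⟨hε, hy⟩
  · exact integrableOn_const hC.measure_lt_top.ne
  · exact (ae_restrict_mem hC.measurableSet).mono fun y hy ε hε =>
      (Γ.density_apply_hasDerivAt φ (hder (ε, φ.map y) (hrK ⟨hε, y, hy, rfl⟩))).const_smul
        (P.weight i (φ.map y))

/-- Differentiation under the integral over a surface. -/
theorem hasDerivAt_integral (Γ : Surface k N)
    {G G' : ℝ → MultiTime N → HCovector N (k + 1)} {Ω : Set (ℝ × MultiTime N)} (hΩ : IsOpen Ω)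
    (h0Ω : ∀ t ∈ Γ.carrier, ((0 : ℝ), t) ∈ Ω)
    (hG : ContinuousOn (fun q : ℝ × MultiTime N => G q.1 q.2) Ω)
    (hG' : ContinuousOn (fun q : ℝ × MultiTime N => G' q.1 q.2) Ω)
    (hder : ∀ q ∈ Ω, HasDerivAt (fun ε => G ε q.2) (G' q.1 q.2) q.1)
    {K : Set (MultiTime N)} (hK : IsCompact K) (hKΓ : K ⊆ Γ.carrier)
    (hGK : ∀ ε, ∀ t ∈ Γ.carrier, t ∉ K → G ε t = 0)
    (hGK' : ∀ t ∈ Γ.carrier, t ∉ K → G' 0 t = 0) :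
    HasDerivAt (fun ε => Γ.integral (G ε)) (Γ.integral (G' 0)) 0 := by
  obtain ⟨T, hT⟩ := Γ.partition.exists_finset_weight_eq_zero hK hKΓ
  simp only [fun ε => Γ.integral_eq_sum (hGK ε) hT, Γ.integral_eq_sum hGK' hT]
  exact HasDerivAt.fun_sum fun i _ =>
    Γ.hasDerivAt_setIntegral_weight_density Γ.partition i hΩ h0Ω hG hG' hder

end Surface

end PluriLagrangian
end

noncomputable section

namespace PluriLagrangian

/-! ### Critical fields -/

section Critical

variable {k N : ℕ}

theorem tsupport_contractForm_subset (Θ : Form1 N k) (u v : MultiTime N → ℂ) :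
    tsupport (contractForm Θ u v) ⊆ tsupport v := fun _ ht => by
  by_contra h
  exact notMem_tsupport_iff_eventuallyEq.2 (contractForm_eventuallyEq_zero Θ u h) ht

theorem jetRestrict_jet_eq_zero (S : Finset (MultiIndex N)) {v : MultiTime N → ℂ}
    {t : MultiTime N} (ht : t ∉ tsupport v) : jetRestrict S (jet v t) = 0 :=
  funext fun I => (jet_eventuallyEq_zero (I : MultiIndex N) ht).self_of_nhds

/-- This is the hypothesis `δ𝓛 = dΘ` evaluated on the variation: pairing the coefficient of each
`δu_I` with `v_I` and summing turns the left side into the linearization of `𝓛` and the right side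
into an exact form. -/
theorem fderiv_eq_neg_extDeriv_contractForm {L : Form0 N (k + 1)} {u v : MultiTime N → ℂ}
    (hu : ContDiff ℝ ∞ u) (hv : ContDiff ℝ ∞ v) {Θ : Form1 N k}
    (hΘ : Θ.IsSmoothOn (Set.range (jet u)))
    (hLΘ : ∀ t I, vertD L I (jet u t) = horizD Θ I (jet u t)) {S : Finset (MultiIndex N)}
    {f : (S → ℂ) → HCovector N (k + 1)} (hLf : ∀ x, L x = f (jetRestrict S x))
    (hf : ∀ t, DifferentiableAt ℝ f (jetRestrict S (jet u t))) (t : MultiTime N) :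
    fderiv ℝ f (jetRestrict S (jet u t)) (jetRestrict S (jet v t)) =
      -extDeriv (contractForm Θ u v) t := by
  classical
  -- Large enough for both sides: the coordinates that `L` depends on, the support of `Θ`, and all
  -- its shifts.
  let T : Finset (MultiIndex N) := S ∪ Θ.support ∪
    Finset.univ.biUnion fun j : Fin N => Θ.support.image (· + Pi.single j 1)
  have hST : S ⊆ T := fun I hI => Finset.mem_union_left _ (Finset.mem_union_left _ hI)
  have hΘT : Θ.support ⊆ T := fun I hI => Finset.mem_union_left _ (Finset.mem_union_right _ hI)
  have hΘT' : ∀ I ∈ Θ.support, ∀ j, I + Pi.single j 1 ∈ T := fun I hI j =>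
    Finset.mem_union_right _ (Finset.mem_biUnion.2
      ⟨j, Finset.mem_univ _, Finset.mem_image_of_mem _ hI⟩)
  rw [← sum_horizD_jet hu hv hΘ t hΘT hΘT', ← sum_jetPartial hLf (hf t) hST]
  exact Finset.sum_congr rfl fun I _ => congrArg (fun A => A (jet v t I)) (hLΘ t I)

end Critical

end PluriLagrangian

end

/-! ### The main theorem -/

theorem mainTheorem5 {k N : ℕ} (L : PluriLagrangian.Form0 N (k + 1))
    (u : PluriLagrangian.MultiTime N → ℂ) (hu : ContDiff ℝ ∞ u)
    (hL : PluriLagrangian.IsDifferentialFunctionOn L (Set.range (PluriLagrangian.jet u)))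
    (h : ∃ Θ : PluriLagrangian.Form1 N k,
      Θ.IsSmoothOn (Set.range (PluriLagrangian.jet u)) ∧
      ∀ (t : PluriLagrangian.MultiTime N) (I : PluriLagrangian.MultiIndex N),
        PluriLagrangian.vertD L I (PluriLagrangian.jet u t) =
          PluriLagrangian.horizD Θ I (PluriLagrangian.jet u t)) :
    ∀ Γ : PluriLagrangian.Surface k N, PluriLagrangian.IsCriticalPoint Γ L u := by
  open PluriLagrangian in
  obtain ⟨Θ, hΘ, hLΘ⟩ := h
  obtain ⟨S, f, hLf, hf⟩ := hL
  have hLf' : ∀ z, L z = f (jetRestrict S z) := hLf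
  intro Γ v hv hvb hvK
  set x : MultiTime N → S → ℂ := fun t => jetRestrict S (jet u t) with hx
  set y : MultiTime N → S → ℂ := fun t => jetRestrict S (jet v t) with hy
  have hxc : Continuous x := (contDiff_jetRestrict_jet hu S).continuous
  have hyc : Continuous y := (contDiff_jetRestrict_jet hv S).continuous
  have hfx : ∀ t, ContDiffAt ℝ 1 f (x t) := fun t => (hf _ ⟨t, rfl⟩).of_le (by simp)
  have hy0 : ∀ t ∉ tsupport v, y t = 0 := fun t ht => jetRestrict_jet_eq_zero S ht
  -- Smoothness is lowered to order `1` because being `C^1` at a point is an open condition, whereas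
  -- for `C^∞` the neighbourhood may shrink with the order.
  have hO : IsOpen {z | ContDiffAt ℝ 1 f z} :=
    isOpen_iff_eventually.2 fun z (hz : ContDiffAt ℝ 1 f z) => hz.eventually (by simp)
  have hγ : Continuous fun q : ℝ × MultiTime N => x q.2 + q.1 • y q.2 := by fun_prop
  -- Jets are linear in the field, so `u + ε v` traces a straight line in the finitely many
  -- coordinates indexed by `S`.
  have hG : (fun ε : ℝ => Γ.integral fun t => L (jet (fun s => u s + ε * v s) t) - L (jet u t)) =
      fun ε => Γ.integral fun t => f (x t + ε • y t) - f (x t) := by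
    ext ε
    congr 1
    ext1 t
    have : jetRestrict S (jet (fun s => u s + ε * v s) t) = x t + ε • y t := by
      ext I
      simp [hx, hy, jetRestrict, jet_add_smul hu hv]
    rw [hLf', hLf', this]
  rw [hG]
  -- The set `Ω` consists of the pairs `(ε, t)` for which `f` is `C^1` at the varied jet. It is open
  -- and contains all `(0, t)`.
  have key := Γ.hasDerivAt_integral (G := fun ε t => f (x t + ε • y t) - f (x t))
    (G' := fun ε t => fderiv ℝ f (x t + ε • y t) (y t)) (hO.preimage hγ)
    (fun t _ => by simpa using hfx t) ?_ ?_ ?_ hvK Set.inter_subset_left ?_ ?_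
  · convert key using 1
    have hneg : ∀ t ∈ Γ.carrier, fderiv ℝ f (x t + (0 : ℝ) • y t) (y t) =
        -extDeriv (contractForm Θ u v) t := fun t _ => by
      rw [zero_smul, add_zero]
      exact fderiv_eq_neg_extDeriv_contractForm hu hv hΘ hLΘ hLf'
        (fun t => (hfx t).differentiableAt one_ne_zero) t
    have hsub := tsupport_contractForm_subset Θ u v
    rw [Γ.integral_congr hneg, Γ.integral_neg, Γ.integral_extDeriv_eq_zero
      (contDiff_contractForm hu hv hΘ), neg_zero]
    · have := hvK.inter_right (isClosed_tsupport (contractForm Θ u v))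
      rwa [Set.inter_assoc, Set.inter_eq_right.2 hsub] at this
    -- Each boundary point has a neighbourhood on which `v` is zero, so it lies outside the closed
    -- support of `v`, hence outside that of the contracted form.
    · refine Set.disjoint_left.2 fun p hp hpv => notMem_tsupport_iff_eventuallyEq.2 ?_ (hsub hpv)
      exact hvb.filter_mono (nhds_le_nhdsSet hp)
  · refine ContinuousOn.sub (fun q hq => ?_) (Continuous.continuousOn ?_)
    · have hq' : ContDiffAt ℝ 1 f (x q.2 + q.1 • y q.2) := hq
      exact (ContinuousAt.comp (g := f) (f := fun q : ℝ × MultiTime N => x q.2 + q.1 • y q.2)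
        hq'.continuousAt hγ.continuousAt).continuousWithinAt
    · have : Continuous fun t => f (x t) :=
        continuous_iff_continuousAt.2 fun t => (hfx t).continuousAt.comp hxc.continuousAt
      exact this.comp continuous_snd
  · refine ContinuousOn.clm_apply (fun q hq => ?_) (hyc.comp continuous_snd).continuousOn
    have hq' : ContDiffAt ℝ 1 f (x q.2 + q.1 • y q.2) := hq
    exact (ContinuousAt.comp (g := fderiv ℝ f)
      (f := fun q : ℝ × MultiTime N => x q.2 + q.1 • y q.2)
      (hq'.fderiv_right (m := 0) (by simp)).continuousAt hγ.continuousAt).continuousWithinAt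
  · intro q hq
    have hq' : ContDiffAt ℝ 1 f (x q.2 + q.1 • y q.2) := hq
    have h1 : HasDerivAt (fun ε : ℝ => x q.2 + ε • y q.2) (y q.2) q.1 := by
      simpa using ((hasDerivAt_id q.1).smul_const (y q.2)).const_add (x q.2)
    exact ((hq'.differentiableAt one_ne_zero).hasFDerivAt.comp_hasDerivAt q.1 h1).sub_const _
  -- Off the support of `v` the varied jet equals the original one for every `ε`, so the difference
  -- of the Lagrangians is exactly zero there.
  · intro ε t ht htK
    simp [hy0 t fun h => htK ⟨ht, h⟩]
  · intro t ht htK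
    simp [hy0 t fun h => htK ⟨ht, h⟩]
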